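/- Let $d\ge 1$ be an integer, $\nu\ge 0$ and $\beta>0$. For a function $\phi:[0,\infty)\to\mathbb R$ with $\int_0^\infty |\phi(r)|\,r^{d-1}\,dr<\infty$, its isotropic spectral density in dimension $d$ is $$\widehat\phi(z)=\frac{z^{1-d/2}}{(2\pi)^{d/2}}\int_0^\infty u^{d/2}J_{d/2-1}(uz)\,\phi(u)\,du,\qquad z>0,$$ where $J_a$ is the Bessel function of the first kind. For $\mu>0$ put $$\delta_{\nu,\mu,\beta}=\beta\left(\frac{\Gamma(\mu+2\nu+1)}{\Gamma(\mu)}\right)^{1/(1+2\nu)},\qquad \varphi_{\nu,\mu,\beta}(r)=\mathcal{GW}_{\nu,\mu,\delta_{\nu,\mu,\beta}}(r),\quad r\ge 0,$$ where $\mathcal{GW}_{\nu,\mu,\delta}$ is the generalized Wendland function: $\mathcal{GW}_{\nu,\mu,\delta}(r)=0$ for $r>\delta$, and for $0\le r\le\delta$ $$\mathcal{GW}_{\nu,\mu,\delta}(r)=\frac{1}{B(2\nu,\mu+1)}\int_{r/\delta}^1 u\,\bigl(u^2-(r/\delta)^2\bigr)^{\nu-1}(1-u)^\mu\,du\quad(\nu>0),\qquad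 \mathcal{GW}_{0,\mu,\delta}(r)=(1-r/\delta)^\mu ,$$ with $B$ the Beta function. Let $$\mathcal M_{\nu+1/2,\beta}(r)=\frac{2^{1/2-\nu}}{\Gamma(\nu+1/2)}\left(\frac r\beta\right)^{\nu+1/2}\mathcal K_{\nu+1/2}\!\left(\frac r\beta\right)$$ (with value $1$ at $r=0$) be the Matérn correlation function, $\mathcal K_a$ being the modified Bessel function of the second kind. Write $\lambda=(d+1)/2+\nu$. Then: 1. For every $\mu>0$, $\varphi_{\nu,\mu,\beta}(r)\,r^{d-1}$ is integrable on $(0,\infty)$, and for every $z>0$, with $\delta=\delta_{\nu,\mu,\beta}$, $$\widehat\varphi_{\nu,\mu,\beta}(z)=\frac{2^{-d}\pi^{-d/2}\,\Gamma(\mu+2\nu+1)\,\Gamma(2\nu+d)\,\Gamma(\nu)\,\delta^d}{\Gamma(\nu+d/2)\,\Gamma(\mu+2\nu+d+1)\,\Gamma(2\nu)}\;{}_1F_2\!\left(\lambda;\lambda+\tfrac{\mu}{2},\lambda+\tfrac{\mu+1}{2};-\tfrac{(z\delta)^2}{4}\right),$$ where for $\nu=0$ the quotient $\Gamma(\nu)/\Gamma(2\nu)$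 is read as its limit $2$, and ${}_1F_2(a;b,c;x)=\sum_{k\ge0}\frac{(a)_k}{(b)_k(c)_k}\frac{x^k}{k!}$ with $(a)_k=a(a+1)\cdots(a+k-1)$. 2. $\mathcal M_{\nu+1/2,\beta}(r)\,r^{d-1}$ is integrable on $(0,\infty)$, and for every $z>0$ $$\widehat{\mathcal M}_{\nu+1/2,\beta}(z)=\frac{\Gamma\bigl(\nu+\frac{d+1}{2}\bigr)}{\pi^{d/2}\,\Gamma\bigl(\nu+\frac12\bigr)}\,\frac{\beta^d}{(1+\beta^2z^2)^{\nu+(d+1)/2}} .$$ 3. As $\mu\to\infty$ through the reals, $\widehat\varphi_{\nu,\mu,\beta}(z)\to\widehat{\mathcal M}_{\nu+1/2,\beta}(z)$, uniformly for $z$ in any bounded subinterval of $(0,\infty)$. -/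

import Mathlib

noncomputable section

namespace Wendland

open MeasureTheory

/-- Bessel function of the first kind of real order `a`, through its power series, at `x > 0`
(the poles of the Gamma function contribute `0`, since `Real.Gamma` vanishes there). -/
def besselJ (a x : ℝ) : ℝ :=
  ∑' k : ℕ, (-1) ^ k / ((k.factorial : ℝ) * Real.Gamma (k + a + 1)) * (x / 2) ^ (2 * (k : ℝ) + a)

/-- Modified Bessel function of the second kind of real order `a`, at `x > 0`. -/
def besselK (a x : ℝ) : ℝ :=
  ∫ t in Set.Ioi (0 : ℝ), Real.exp (-x * Real.cosh t) * Real.cosh (a * t)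

/-- The generalized hypergeometric function `₁F₂(a; b, c; x)`. -/
def hypergeometric1F2 (a b c x : ℝ) : ℝ :=
  ∑' k : ℕ, (ascPochhammer ℝ k).eval a /
    ((ascPochhammer ℝ k).eval b * (ascPochhammer ℝ k).eval c) * (x ^ k / (k.factorial : ℝ))

/-- The isotropic spectral density in dimension `d` of `φ : [0,∞) → ℝ`, at `z > 0`: the radial
profile of `ξ ↦ (2π)^{-d} ∫ exp(-i⟨x,ξ⟩) φ(‖x‖) dx` on `ℝ^d`, written as a Hankel transform. -/
def spectralDensity (d : ℕ) (φ : ℝ → ℝ) (z : ℝ) : ℝ :=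
  z ^ (1 - (d : ℝ) / 2) / (2 * Real.pi) ^ ((d : ℝ) / 2) *
    ∫ u in Set.Ioi (0 : ℝ), u ^ ((d : ℝ) / 2) * besselJ ((d : ℝ) / 2 - 1) (u * z) * φ u

/-- The Matérn correlation function `M_{ν,β}(r)`, for `r ≥ 0` (at `r = 0` by continuity). -/
def matern (ν β r : ℝ) : ℝ :=
  if r = 0 then 1
  else 2 ^ (1 - ν) / Real.Gamma ν * (r / β) ^ ν * besselK ν (r / β)

/-- The closed form of the Matérn spectral density in dimension `d`. -/
def maternDensity (d : ℕ) (ν β z : ℝ) : ℝ :=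
  Real.Gamma (ν + (d : ℝ) / 2) / (Real.pi ^ ((d : ℝ) / 2) * Real.Gamma ν) *
    (β ^ d / (1 + β ^ 2 * z ^ 2) ^ (ν + (d : ℝ) / 2))

/-- The generalized Wendland correlation function `GW_{ν,μ,β}(r)`, for `r ≥ 0`; for `ν = 0` it is
the Askey function. -/
def genWendland (ν μ β r : ℝ) : ℝ :=
  if r ≤ β then
    if ν = 0 then (1 - r / β) ^ μ
    else 1 / ProbabilityTheory.beta (2 * ν) (μ + 1) *
      ∫ u in (r / β)..1, u * (u ^ 2 - (r / β) ^ 2) ^ (ν - 1) * (1 - u) ^ μ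
  else 0

/-- `λ(d,ν) = (d+1)/2 + ν`. -/
def lam (d : ℕ) (ν : ℝ) : ℝ := ((d : ℝ) + 1) / 2 + ν

/-- `Γ(ν)/Γ(2ν)`, with its limit `2` at `ν = 0`. -/
def gammaRatio (ν : ℝ) : ℝ := if ν = 0 then 2 else Real.Gamma ν / Real.Gamma (2 * ν)

/-- The closed form of the generalized Wendland spectral density in dimension `d`. -/
def genWendlandDensity (d : ℕ) (ν μ β z : ℝ) : ℝ :=
  2 ^ (-(d : ℝ)) * Real.pi ^ (-(d : ℝ) / 2) * Real.Gamma (μ + 2 * ν + 1) *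
      Real.Gamma (2 * ν + d) * gammaRatio ν /
      (Real.Gamma (ν + (d : ℝ) / 2) * Real.Gamma (μ + 2 * ν + d + 1)) * β ^ d *
    hypergeometric1F2 (lam d ν) (lam d ν + μ / 2) (lam d ν + (μ + 1) / 2) (-(z * β) ^ 2 / 4)

/-- The compact support parameter `δ_{ν,μ,β}`. -/
def delta (ν μ β : ℝ) : ℝ :=
  β * (Real.Gamma (μ + 2 * ν + 1) / Real.Gamma μ) ^ (1 / (1 + 2 * ν))

/-- The reparametrized generalized Wendland correlation `φ_{ν,μ,β}`. -/
def phi (ν μ β r : ℝ) : ℝ := genWendland ν μ (delta ν μ β) r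

end Wendland

end

noncomputable section

namespace Wendland

open MeasureTheory Set Filter Topology

/-! The spectral density is, up to a constant, the integral of `φ u * u ^ (d - 1)` against the
entire function `besselEntire (d / 2 - 1)` at `u * z`. That function is bounded by its value at 0
(`abs_besselEntire_le`), so two spectral densities differ by at most a constant, independent of `z`,
times the weighted L¹ distance of the functions (`abs_spectralDensity_sub_le`). The limit is thereby
reduced to L¹ convergence.

For `ν > 0` both functions are the same fractional integral, applied to the truncated power `(1 - w
/ δ)₊ ^ μ` on one side (`genWendland_of_pos`) and to `exp (-w / β)` on the other
(`matern_eq_fracIntegral`); for `ν = 0` they are these two functions themselves. By Tonelli the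
fractional integral is bounded between weighted L¹ spaces (`integral_rpow_mul_abs_fracIntegral_le`).
It remains to see that the truncated power tends to the exponential in weighted L¹, which is
dominated convergence once `δ / μ → β` (`tendsto_integral_abs_askey_sub_exp`, `tendsto_delta_div`),
and that the normalising constants agree in the limit (`delta_rpow_div_beta`).

The closed forms are separate computations. A Wendland function has compact support and explicit
moments, so the Bessel series is integrated term by term and resummed as a ₁F₂. A Matérn function is
a Gamma mixture of Gaussians, whose Hankel transforms are again Gaussians, and a Gamma integral
remains. -/

/-! ### Beta integrals over real intervals. -/

theorem integrableOn_rpow_mul_one_sub_rpow {a b : ℝ} (ha : 0 < a) (hb : 0 < b) :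
    IntegrableOn (fun x : ℝ => x ^ (a - 1) * (1 - x) ^ (b - 1)) (Ioo 0 1) := by
  have h := Complex.betaIntegral_convergent (u := a) (v := b) (by simpa) (by simpa)
  rw [intervalIntegrable_iff_integrableOn_Ioo_of_le zero_le_one] at h
  refine (integrableOn_congr_fun (fun x hx => ?_) measurableSet_Ioo).mp h.re
  have h1 : (0 : ℝ) ≤ x := hx.1.le
  have h2 : (0 : ℝ) ≤ 1 - x := by linarith [hx.2]
  have e : (x : ℂ) ^ ((a : ℂ) - 1) * (1 - (x : ℂ)) ^ ((b : ℂ) - 1)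
      = ((x ^ (a - 1) * (1 - x) ^ (b - 1) : ℝ) : ℂ) := by
    rw [Complex.ofReal_mul, Complex.ofReal_cpow h1, Complex.ofReal_cpow h2]
    push_cast
    rfl
  simp only [e]
  simp only [RCLike.re_to_complex, Complex.ofReal_re]

theorem integral_rpow_mul_one_sub_rpow {a b : ℝ} (ha : 0 < a) (hb : 0 < b) :
    ∫ x in Ioo (0 : ℝ) 1, x ^ (a - 1) * (1 - x) ^ (b - 1) = ProbabilityTheory.beta a b := by
  rw [ProbabilityTheory.beta_eq_betaIntegralReal a b ha hb, Complex.betaIntegral,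
    intervalIntegral.integral_of_le zero_le_one, integral_Ioc_eq_integral_Ioo]
  have e : ∫ x in Ioo (0 : ℝ) 1, (x : ℂ) ^ ((a : ℂ) - 1) * (1 - (x : ℂ)) ^ ((b : ℂ) - 1)
      = ∫ x in Ioo (0 : ℝ) 1, ((x ^ (a - 1) * (1 - x) ^ (b - 1) : ℝ) : ℂ) := by
    refine setIntegral_congr_fun measurableSet_Ioo fun x hx => ?_
    have h1 : (0 : ℝ) ≤ x := hx.1.le
    have h2 : (0 : ℝ) ≤ 1 - x := by linarith [hx.2]
    rw [Complex.ofReal_mul, Complex.ofReal_cpow h1, Complex.ofReal_cpow h2]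
    push_cast
    rfl
  rw [e, integral_complex_ofReal, Complex.ofReal_re]

theorem image_div_Ioo {c : ℝ} (hc : 0 < c) : (fun x : ℝ => x / c) '' Ioo 0 c = Ioo 0 1 := by
  ext y
  constructor
  · rintro ⟨x, ⟨h0, h1⟩, rfl⟩
    exact ⟨by positivity, (div_lt_one hc).2 h1⟩
  · rintro ⟨h0, h1⟩
    exact ⟨y * c, ⟨by positivity, by nlinarith⟩, by simp [hc.ne']⟩

theorem integral_beta_scaled {a b c : ℝ} (ha : 0 < a) (hb : 0 < b) (hc : 0 < c) :
    IntegrableOn (fun x : ℝ => x ^ (a - 1) * (1 - x / c) ^ (b - 1)) (Ioo 0 c) ∧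
    ∫ x in Ioo (0 : ℝ) c, x ^ (a - 1) * (1 - x / c) ^ (b - 1)
      = c ^ a * ProbabilityTheory.beta a b := by
  have hd : ∀ x ∈ Ioo (0 : ℝ) c, HasDerivWithinAt (fun x : ℝ => x / c) (1 / c) (Ioo 0 c) x :=
    fun x _ => ((hasDerivAt_id x).div_const c).hasDerivWithinAt
  have hinj : InjOn (fun x : ℝ => x / c) (Ioo 0 c) := fun x _ y _ h =>
    (div_left_inj' hc.ne').1 h
  have hcongr : EqOn (fun x : ℝ => c ^ a * (|1 / c| • ((x / c) ^ (a - 1) * (1 - x / c) ^ (b - 1))))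
      (fun x : ℝ => x ^ (a - 1) * (1 - x / c) ^ (b - 1)) (Ioo 0 c) := by
    intro x hx
    simp only [smul_eq_mul]
    rw [abs_of_pos (by positivity), Real.div_rpow hx.1.le hc.le, Real.rpow_sub_one hc.ne']
    have := (Real.rpow_pos_of_pos hc a).ne'
    field_simp
  constructor
  · have h := integrableOn_rpow_mul_one_sub_rpow ha hb
    rw [← image_div_Ioo hc,
      integrableOn_image_iff_integrableOn_abs_deriv_smul measurableSet_Ioo hd hinj] at h
    exact (integrableOn_congr_fun hcongr measurableSet_Ioo).1 (h.const_mul (c ^ a))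
  · rw [← integral_rpow_mul_one_sub_rpow ha hb, ← image_div_Ioo hc,
      integral_image_eq_integral_abs_deriv_smul measurableSet_Ioo hd hinj,
      ← integral_const_mul]
    exact (setIntegral_congr_fun measurableSet_Ioo hcongr).symm

theorem image_sq_div_Ioo {w : ℝ} (hw : 0 < w) :
    (fun x : ℝ => (x / w) ^ 2) '' Ioo 0 w = Ioo 0 1 := by
  ext y
  constructor
  · rintro ⟨x, ⟨h0, h1⟩, rfl⟩
    have h2 : x / w < 1 := (div_lt_one hw).2 h1
    have h3 : 0 < x / w := by positivity
    exact ⟨by positivity, by simp only; nlinarith⟩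
  · rintro ⟨h0, h1⟩
    have h2 : √y < 1 := by rw [Real.sqrt_lt' one_pos]; simpa
    have h3 : 0 < √y := Real.sqrt_pos.2 h0
    refine ⟨√y * w, ⟨by positivity, by nlinarith⟩, ?_⟩
    simp [hw.ne', Real.sq_sqrt h0.le]

/-- The substitution `y = (r / w) ^ 2` gives a Beta integral. It serves twice: for Poisson's
integral of the Bessel function, and as the inner integral when the fractional integral is
integrated by Tonelli. -/
theorem integral_rpow_mul_sq_sub_sq_rpow {s ν w : ℝ} (hs : 0 < s) (hν : 0 < ν) (hw : 0 < w) :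
    IntegrableOn (fun r : ℝ => r ^ (s - 1) * (w ^ 2 - r ^ 2) ^ (ν - 1)) (Ioo 0 w) ∧
    ∫ r in Ioo (0 : ℝ) w, r ^ (s - 1) * (w ^ 2 - r ^ 2) ^ (ν - 1)
      = w ^ (s + 2 * ν - 2) * (ProbabilityTheory.beta (s / 2) ν / 2) := by
  have hd : ∀ x ∈ Ioo (0 : ℝ) w,
      HasDerivWithinAt (fun x : ℝ => (x / w) ^ 2) (2 * x / w ^ 2) (Ioo 0 w) x := by
    intro x _
    have := (((hasDerivAt_id x).div_const w).pow 2).hasDerivWithinAt (s := Ioo 0 w)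
    refine this.congr_deriv ?_
    simp only [id]
    field_simp
    norm_num
    field_simp
  have hinj : InjOn (fun x : ℝ => (x / w) ^ 2) (Ioo 0 w) := by
    intro x hx y hy h
    simp only at h
    rw [div_pow, div_pow, div_left_inj' (by positivity)] at h
    exact (pow_left_inj₀ hx.1.le hy.1.le two_ne_zero).1 h
  have hcongr : EqOn (fun x : ℝ => w ^ (s + 2 * ν - 2) / 2 *
        (|2 * x / w ^ 2| • (((x / w) ^ 2) ^ (s / 2 - 1) * (1 - (x / w) ^ 2) ^ (ν - 1))))
      (fun r : ℝ => r ^ (s - 1) * (w ^ 2 - r ^ 2) ^ (ν - 1)) (Ioo 0 w) := by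
    intro x hx
    have hx0 := hx.1
    have hlt : 0 < w ^ 2 - x ^ 2 := by nlinarith [hx.1, hx.2]
    simp only [smul_eq_mul]
    have e1 : 1 - (x / w) ^ 2 = (w ^ 2 - x ^ 2) / w ^ 2 := by field_simp
    rw [abs_of_pos (by positivity), e1, Real.div_rpow hlt.le (by positivity),
      ← Real.rpow_natCast (x / w) 2, ← Real.rpow_mul (by positivity),
      Real.div_rpow hx0.le hw.le, ← Real.rpow_natCast w 2, ← Real.rpow_mul hw.le]
    push_cast
    have e2 : w ^ (s + 2 * ν - 2) = w ^ (2 * (s / 2 - 1)) * w ^ (2 * (ν - 1)) * w ^ (2 : ℝ) := by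
      rw [← Real.rpow_add hw, ← Real.rpow_add hw]; congr 1; ring
    have e3 : x ^ (s - 1) = x ^ (2 * (s / 2 - 1)) * x := by
      rw [← Real.rpow_add_one hx0.ne']; congr 1; ring
    rw [e2, e3]
    have p1 := (Real.rpow_pos_of_pos hw (2 * (s / 2 - 1))).ne'
    have p2 := (Real.rpow_pos_of_pos hw (2 * (ν - 1))).ne'
    have p3 := (Real.rpow_pos_of_pos hw 2).ne'
    field_simp
  constructor
  · have h := integrableOn_rpow_mul_one_sub_rpow (half_pos hs) hν
    rw [← image_sq_div_Ioo hw,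
      integrableOn_image_iff_integrableOn_abs_deriv_smul measurableSet_Ioo hd hinj] at h
    exact (integrableOn_congr_fun hcongr measurableSet_Ioo).1 (h.const_mul (w ^ (s + 2 * ν - 2) / 2))
  · rw [← integral_rpow_mul_one_sub_rpow (half_pos hs) hν, ← image_sq_div_Ioo hw,
      integral_image_eq_integral_abs_deriv_smul measurableSet_Ioo hd hinj,
      ← mul_div_assoc, mul_div_right_comm, ← integral_const_mul]
    exact (setIntegral_congr_fun measurableSet_Ioo hcongr).symm

/-! ### The normalised Bessel function: series, termwise integration, uniform bound. -/

/-- The entire function `(x / 2) ^ (-a) * J_a(x)`. -/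
def besselEntire (a x : ℝ) : ℝ :=
  ∑' k : ℕ, (-1) ^ k / ((k.factorial : ℝ) * Real.Gamma (k + a + 1)) * (x / 2) ^ (2 * k)

/-- Gamma attains a positive minimum on the positive axis. This crude bound suffices to compare the
Bessel series with an exponential series. -/
theorem exists_pos_le_Gamma : ∃ c : ℝ, 0 < c ∧ ∀ x : ℝ, 0 < x → c ≤ Real.Gamma x := by
  obtain ⟨x, hx, hmin⟩ := Real.exists_isMinOn_Gamma_Ioi
  exact ⟨Real.Gamma x, Real.Gamma_pos_of_pos (by linarith [hx.1]), fun y hy => hmin hy⟩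

theorem summable_besselEntire_abs {a : ℝ} (ha : -1 < a) (x : ℝ) :
    Summable fun k : ℕ => 1 / ((k.factorial : ℝ) * Real.Gamma (k + a + 1)) * (x / 2) ^ (2 * k) := by
  obtain ⟨c, hc, hG⟩ := exists_pos_le_Gamma
  refine Summable.of_nonneg_of_le (fun k => ?_) (fun k => ?_)
    ((Real.summable_pow_div_factorial ((x / 2) ^ 2)).mul_left (1 / c))
  · have : 0 < Real.Gamma (k + a + 1) := Real.Gamma_pos_of_pos (by
      have : (0 : ℝ) ≤ k := by positivity
      linarith)
    rw [pow_mul]; positivity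
  · have h1 : c ≤ Real.Gamma (k + a + 1) := hG _ (by
      have : (0 : ℝ) ≤ k := by positivity
      linarith)
    rw [pow_mul, ← mul_div_assoc, mul_comm (1 / c), mul_div_assoc, mul_comm]
    refine mul_le_mul_of_nonneg_left ?_ (by positivity)
    rw [div_div, mul_comm]
    exact one_div_le_one_div_of_le (by positivity) (by gcongr)

theorem hasSum_besselEntire {a : ℝ} (ha : -1 < a) (x : ℝ) :
    HasSum (fun k : ℕ => (-1) ^ k / ((k.factorial : ℝ) * Real.Gamma (k + a + 1)) *
      (x / 2) ^ (2 * k)) (besselEntire a x) := by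
  refine Summable.hasSum (Summable.of_norm ((summable_besselEntire_abs ha x).congr fun k => ?_))
  have : 0 < Real.Gamma (k + a + 1) := Real.Gamma_pos_of_pos (by
      have : (0 : ℝ) ≤ k := by positivity
      linarith)
  rw [norm_mul, norm_div, norm_pow, norm_neg, norm_one, one_pow, pow_mul,
    Real.norm_of_nonneg (by positivity), Real.norm_of_nonneg (by positivity)]

theorem besselJ_eq_rpow_mul_besselEntire (a : ℝ) {x : ℝ} (hx : 0 < x) :
    besselJ a x = (x / 2) ^ a * besselEntire a x := by
  rw [besselJ, besselEntire, ← tsum_mul_left]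
  refine tsum_congr fun k => ?_
  rw [Real.rpow_add (by positivity), ← Real.rpow_natCast (x / 2) (2 * k)]
  push_cast
  ring

theorem measurable_besselEntire {a : ℝ} (ha : -1 < a) : Measurable (besselEntire a) := by
  refine measurable_of_tendsto_metrizable
    (f := fun n : ℕ => fun x : ℝ => ∑ k ∈ Finset.range n,
      (-1) ^ k / ((k.factorial : ℝ) * Real.Gamma (k + a + 1)) * (x / 2) ^ (2 * k))
    (fun n => by fun_prop) ?_
  rw [tendsto_pi_nhds]
  exact fun x => (hasSum_besselEntire ha x).tendsto_sum_nat

theorem hasSum_integral_besselEntire {a : ℝ} (ha : -1 < a) (z : ℝ) {g : ℝ → ℝ}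
    (hint : ∀ k : ℕ, IntegrableOn (fun u => u ^ (2 * k) * g u) (Ioi 0))
    (hsum : Summable fun k : ℕ => 1 / ((k.factorial : ℝ) * Real.Gamma (k + a + 1)) *
      (z / 2) ^ (2 * k) * ∫ u in Ioi (0 : ℝ), u ^ (2 * k) * |g u|) :
    HasSum (fun k : ℕ => (-1) ^ k / ((k.factorial : ℝ) * Real.Gamma (k + a + 1)) *
      (z / 2) ^ (2 * k) * ∫ u in Ioi (0 : ℝ), u ^ (2 * k) * g u)
      (∫ u in Ioi (0 : ℝ), besselEntire a (u * z) * g u) := by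
  have h := hasSum_integral_of_summable_integral_norm (μ := volume.restrict (Ioi (0 : ℝ)))
    (F := fun (k : ℕ) u => (-1) ^ k / ((k.factorial : ℝ) * Real.Gamma (k + a + 1)) *
      (z / 2) ^ (2 * k) * (u ^ (2 * k) * g u)) (fun k => (hint k).const_mul _) (by
      refine hsum.congr fun k => ?_
      have : 0 < Real.Gamma (k + a + 1) := Real.Gamma_pos_of_pos (by
        have : (0 : ℝ) ≤ k := by positivity
        linarith)
      rw [← integral_const_mul]
      refine integral_congr_ae (Filter.Eventually.of_forall fun u => ?_)
      have e1 : (0 : ℝ) ≤ (z / 2) ^ (2 * k) := by rw [pow_mul]; positivity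
      have e2 : (0 : ℝ) ≤ u ^ (2 * k) := by rw [pow_mul]; positivity
      simp only
      rw [norm_mul, norm_mul, norm_mul, Real.norm_of_nonneg e1, Real.norm_of_nonneg e2, norm_div,
        norm_pow, norm_neg, norm_one, one_pow, Real.norm_of_nonneg (by positivity),
        Real.norm_eq_abs])
  have e : ∫ u in Ioi (0 : ℝ), besselEntire a (u * z) * g u
      = ∫ u in Ioi (0 : ℝ), ∑' k : ℕ, (-1) ^ k / ((k.factorial : ℝ) * Real.Gamma (k + a + 1)) *
      (z / 2) ^ (2 * k) * (u ^ (2 * k) * g u) := by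
    refine integral_congr_ae (Filter.Eventually.of_forall fun u => ?_)
    simp only
    rw [besselEntire, ← tsum_mul_right]
    refine tsum_congr fun k => ?_
    rw [mul_div_assoc, mul_pow]
    ring
  rw [e]
  simpa only [integral_const_mul] using h

/-- On the support `u ^ (2 * k) ≤ R ^ (2 * k)`, so the integrated series is dominated by the
absolute Bessel series at `R * z`. -/
theorem hasSum_integral_besselEntire_of_eq_zero {a : ℝ} (ha : -1 < a) (z : ℝ) {g : ℝ → ℝ} {R : ℝ}
    (hg : IntegrableOn g (Ioi 0)) (hR : ∀ u, R < u → g u = 0) :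
    HasSum (fun k : ℕ => (-1) ^ k / ((k.factorial : ℝ) * Real.Gamma (k + a + 1)) *
      (z / 2) ^ (2 * k) * ∫ u in Ioi (0 : ℝ), u ^ (2 * k) * g u)
      (∫ u in Ioi (0 : ℝ), besselEntire a (u * z) * g u) := by
  have hbd : ∀ k : ℕ, ∀ u ∈ Ioi (0 : ℝ), u ^ (2 * k) * |g u| ≤ R ^ (2 * k) * |g u| := by
    intro k u hu
    rcases le_or_gt u R with h | h
    · have : (0 : ℝ) ≤ u := le_of_lt hu
      gcongr
    · simp [hR u h]
  have hint : ∀ k : ℕ, IntegrableOn (fun u => u ^ (2 * k) * g u) (Ioi 0) := by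
    intro k
    refine (hg.norm.const_mul (R ^ (2 * k))).mono'
      ((by fun_prop : Measurable fun u : ℝ => u ^ (2 * k)).aestronglyMeasurable.mul
        hg.aestronglyMeasurable) ?_
    filter_upwards [ae_restrict_mem measurableSet_Ioi] with u hu
    rw [norm_mul, norm_pow, Real.norm_of_nonneg (le_of_lt hu)]
    exact hbd k u hu
  refine hasSum_integral_besselEntire ha z hint ?_
  have hG : ∀ k : ℕ, 0 < Real.Gamma (k + a + 1) := fun k => Real.Gamma_pos_of_pos (by
    have : (0 : ℝ) ≤ k := by positivity
    linarith)
  refine Summable.of_nonneg_of_le (fun k => ?_) (fun k => ?_)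
    ((summable_besselEntire_abs ha (R * z)).mul_right (∫ u in Ioi (0 : ℝ), |g u|))
  · have := hG k
    rw [pow_mul]
    refine mul_nonneg (by positivity) (setIntegral_nonneg measurableSet_Ioi fun u hu => ?_)
    have : (0 : ℝ) < u := hu
    positivity
  · have := hG k
    have h1 : ∫ u in Ioi (0 : ℝ), u ^ (2 * k) * |g u| ≤ ∫ u in Ioi (0 : ℝ), R ^ (2 * k) * |g u| := by
      refine setIntegral_mono_on ?_ (hg.abs.const_mul _) measurableSet_Ioi (hbd k)
      refine (integrableOn_congr_fun (fun u hu => ?_) measurableSet_Ioi).1 (hint k).abs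
      rw [abs_mul, abs_of_nonneg (pow_nonneg (le_of_lt hu) _)]
    rw [integral_const_mul] at h1
    have h2 : (0 : ℝ) ≤ (z / 2) ^ (2 * k) := by rw [pow_mul]; positivity
    calc _ ≤ _ := mul_le_mul_of_nonneg_left h1 (by positivity)
      _ = _ := by rw [mul_div_assoc, mul_pow]; ring

/-- Legendre duplication at half-integers; it turns the series of order `-1/2` into the cosine
series. -/
theorem factorial_mul_Gamma_add_half (k : ℕ) :
    (k.factorial : ℝ) * Real.Gamma (k + -(1 / 2) + 1) * 2 ^ (2 * k)
      = ((2 * k).factorial : ℝ) * √Real.pi := by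
  induction k with
  | zero =>
    have : (-(1 / 2) + 1 : ℝ) = 1 / 2 := by norm_num
    simp only [Nat.factorial_zero, Nat.cast_one, one_mul, Nat.cast_zero, zero_add, this,
      Real.Gamma_one_half_eq, mul_zero, pow_zero, mul_one]
  | succ k ih =>
    have h0 : (k : ℝ) + -(1 / 2) + 1 ≠ 0 := by
      have : (0 : ℝ) ≤ k := by positivity
      linarith
    rw [show ((k + 1 : ℕ) : ℝ) + -(1 / 2) + 1 = ((k : ℝ) + -(1 / 2) + 1) + 1 by push_cast; ring,
      Real.Gamma_add_one h0, show 2 * (k + 1) = (2 * k + 1) + 1 by ring, Nat.factorial_succ,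
      Nat.factorial_succ (2 * k + 1), Nat.factorial_succ (2 * k)]
    push_cast
    linear_combination ((k : ℝ) + 1) * (2 * k + 1) * 2 * ih

theorem besselEntire_neg_half (x : ℝ) :
    besselEntire (-(1 / 2)) x = Real.cos x / √Real.pi := by
  refine (hasSum_besselEntire (by norm_num) x).unique ?_
  refine ((Real.hasSum_cos x).div_const (√Real.pi)).congr_fun ?_
  intro k
  have h := factorial_mul_Gamma_add_half k
  have h1 : 0 < √Real.pi := Real.sqrt_pos.2 Real.pi_pos
  have h2 : (0 : ℝ) < ((2 * k).factorial : ℝ) := by positivity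
  have h3 : ((k.factorial : ℝ) * Real.Gamma (k + -(1 / 2) + 1)) ≠ 0 := by
    intro h0
    rw [h0, zero_mul] at h
    exact (mul_pos h2 h1).ne h
  rw [div_pow, div_mul_div_comm, div_div, h]

/-- Poisson's integral: for `a > -1/2` the function is a positive average of cosines with weight `(1
- t ^ 2) ^ (a - 1/2)`, so it is largest in modulus at 0. The endpoint `a = -1/2`, needed for `d =
1`, is the cosine itself. -/
theorem abs_besselEntire_le {a : ℝ} (ha : -(1 / 2) ≤ a) (x : ℝ) :
    |besselEntire a x| ≤ 1 / Real.Gamma (a + 1) := by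
  have hcos : ∀ y, |besselEntire (-(1 / 2)) y| ≤ 1 / √Real.pi := by
    intro y
    rw [besselEntire_neg_half, abs_div, abs_of_pos (Real.sqrt_pos.2 Real.pi_pos)]
    exact div_le_div_of_nonneg_right (Real.abs_cos_le_one y) (Real.sqrt_nonneg _)
  rcases ha.eq_or_lt with rfl | ha
  · have : (-(1 / 2) + 1 : ℝ) = 1 / 2 := by norm_num
    rw [this, Real.Gamma_one_half_eq]
    exact hcos x
  set b := a + 1 / 2 with hb
  have hb0 : 0 < b := by linarith
  set g : ℝ → ℝ := (Ioo (0 : ℝ) 1).indicator fun t => (1 - t ^ 2) ^ (b - 1) with hg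
  have hmom : ∀ k : ℕ, IntegrableOn (fun u => u ^ (2 * k) * g u) (Ioi 0) ∧
      ∫ u in Ioi (0 : ℝ), u ^ (2 * k) * g u = ProbabilityTheory.beta (k + 1 / 2) b / 2 := by
    intro k
    obtain ⟨h1, h2⟩ := integral_rpow_mul_sq_sub_sq_rpow (s := 2 * k + 1) (ν := b) (w := 1)
      (by positivity) hb0 one_pos
    have e : (fun u => u ^ (2 * k) * g u) = (Ioo (0 : ℝ) 1).indicator fun r : ℝ =>
        r ^ ((2 * k + 1 : ℝ) - 1) * (1 ^ 2 - r ^ 2) ^ (b - 1) := by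
      ext u
      by_cases hu : u ∈ Ioo (0 : ℝ) 1
      · simp only [hg, indicator_of_mem hu, one_pow, add_sub_cancel_right]
        rw [← Real.rpow_natCast]
        push_cast
        rfl
      · simp only [hg, indicator_of_notMem hu, mul_zero]
    have hsub : Ioi (0 : ℝ) ∩ Ioo 0 1 = Ioo 0 1 := inter_eq_self_of_subset_right fun x hx => hx.1
    rw [e]
    constructor
    · rw [integrableOn_indicator_iff measurableSet_Ioo, inter_comm, hsub]
      exact h1
    · rw [setIntegral_indicator measurableSet_Ioo, hsub, h2, Real.one_rpow, one_mul]
      congr 2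
      ring
  have hsum := hasSum_integral_besselEntire_of_eq_zero (a := -(1 / 2)) (by norm_num) x (g := g)
    (R := 1) (by simpa using (hmom 0).1) (fun u hu => indicator_of_notMem (fun h => by
      linarith [h.2]) _)
  -- Poisson's formula, checked by matching coefficients: the Beta moments of `g` replace `Γ(k +
  -- 1/2)` by `Γ(k + a + 1)`.
  have hval : (∫ u in Ioi (0 : ℝ), besselEntire (-(1 / 2)) (u * x) * g u)
      = Real.Gamma b / 2 * besselEntire a x := by
    refine hsum.unique (((hasSum_besselEntire (by linarith) x).mul_left _).congr_fun fun k => ?_)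
    rw [(hmom k).2, ProbabilityTheory.beta, show (k : ℝ) + 1 / 2 + b = k + a + 1 by rw [hb]; ring,
      show (k : ℝ) + -(1 / 2) + 1 = k + 1 / 2 by ring]
    have := (Real.Gamma_pos_of_pos (show (0 : ℝ) < k + 1 / 2 by positivity)).ne'
    field_simp
  have hbound : |∫ u in Ioi (0 : ℝ), besselEntire (-(1 / 2)) (u * x) * g u|
      ≤ ∫ u in Ioi (0 : ℝ), 1 / √Real.pi * g u := by
    have hi : IntegrableOn (fun u => 1 / √Real.pi * g u) (Ioi 0) := by
      refine Integrable.const_mul ?_ _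
      simpa [IntegrableOn] using (hmom 0).1
    rw [← Real.norm_eq_abs]
    refine norm_integral_le_of_norm_le hi (Filter.Eventually.of_forall fun u => ?_)
    have : 0 ≤ g u := indicator_nonneg (fun t ht => Real.rpow_nonneg (by nlinarith [ht.1, ht.2]) _) u
    rw [norm_mul, Real.norm_of_nonneg this]
    exact mul_le_mul_of_nonneg_right (hcos _) this
  have h0 := (hmom 0).2
  simp only [mul_zero, pow_zero, one_mul, Nat.cast_zero, zero_add] at h0
  rw [hval, integral_const_mul, h0, abs_mul, ProbabilityTheory.beta, Real.Gamma_one_half_eq,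
    abs_of_pos (by have := Real.Gamma_pos_of_pos hb0; positivity),
    show (1 / 2 : ℝ) + b = a + 1 by rw [hb]; ring] at hbound
  have hGb := Real.Gamma_pos_of_pos hb0
  have h1 : 0 < √Real.pi := Real.sqrt_pos.2 Real.pi_pos
  refine le_of_mul_le_mul_left (hbound.trans_eq ?_) (half_pos hGb)
  field_simp

/-- The prefactor `z ^ (1 - d / 2)` cancels the power of `z` in the Bessel function, which leaves a
kernel bounded uniformly in `z` and the radial weight `u ^ (d - 1)`. -/
theorem spectralDensity_eq_integral_besselEntire {d : ℕ} (hd : 1 ≤ d) (φ : ℝ → ℝ) {z : ℝ}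
    (hz : 0 < z) :
    spectralDensity d φ z = 2 ^ (1 - (d : ℝ) / 2) / (2 * Real.pi) ^ ((d : ℝ) / 2) *
      ∫ u in Ioi (0 : ℝ), besselEntire ((d : ℝ) / 2 - 1) (u * z) * (φ u * u ^ (d - 1)) := by
  rw [spectralDensity, ← integral_const_mul, ← integral_const_mul]
  refine setIntegral_congr_fun measurableSet_Ioi fun u hu => ?_
  have hu : 0 < u := hu
  rw [besselJ_eq_rpow_mul_besselEntire _ (mul_pos hu hz), Real.div_rpow (by positivity) zero_le_two,
    Real.mul_rpow hu.le hz.le]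
  have e1 : u ^ (d - 1) = u ^ ((d : ℝ) / 2) * u ^ ((d : ℝ) / 2 - 1) := by
    rw [← Real.rpow_add hu, ← Real.rpow_natCast, Nat.cast_sub hd]
    congr 1
    push_cast
    ring
  have e2 : z ^ (1 - (d : ℝ) / 2) * z ^ ((d : ℝ) / 2 - 1) = 1 := by
    rw [← Real.rpow_add hz]; simp
  have e3 : (2 : ℝ) ^ (1 - (d : ℝ) / 2) = ((2 : ℝ) ^ ((d : ℝ) / 2 - 1))⁻¹ := by
    rw [← Real.rpow_neg zero_le_two]; congr 1; ring
  rw [e1, e3]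
  linear_combination (u ^ ((d : ℝ) / 2) * u ^ ((d : ℝ) / 2 - 1) *
    besselEntire ((d : ℝ) / 2 - 1) (u * z) * φ u * ((2 : ℝ) ^ ((d : ℝ) / 2 - 1))⁻¹ /
    (2 * Real.pi) ^ ((d : ℝ) / 2)) * e2

theorem two_rpow_div_two_mul_pi_rpow (d : ℝ) :
    (2 : ℝ) ^ (1 - d / 2) / (2 * Real.pi) ^ (d / 2)
      = 2 * (2 ^ (-d) * Real.pi ^ (-d / 2)) := by
  rw [Real.mul_rpow zero_le_two Real.pi_pos.le, neg_div, Real.rpow_neg Real.pi_pos.le,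
    Real.rpow_neg zero_le_two, Real.rpow_sub two_pos, Real.rpow_one]
  have : (2 : ℝ) ^ d = 2 ^ (d / 2) * 2 ^ (d / 2) := by
    rw [← Real.rpow_add two_pos]; congr 1; ring
  rw [this]
  field_simp

/-! ### The fractional integral on weighted L¹ spaces. -/

/-- The fractional integral `r ↦ ∫_r^∞ w (w² - r²)^{ν-1} h(w) dw`. -/
def fracIntegral (ν : ℝ) (h : ℝ → ℝ) (r : ℝ) : ℝ :=
  ∫ w in Ioi r, w * (w ^ 2 - r ^ 2) ^ (ν - 1) * h w

/-- The integrand of the double integral of `r ^ (s - 1) * fracIntegral ν h r`. -/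
def fracKernel (s ν : ℝ) (h : ℝ → ℝ) (p : ℝ × ℝ) : ℝ :=
  {p : ℝ × ℝ | p.1 < p.2}.indicator
    (fun p => p.1 ^ (s - 1) * (p.2 * (p.2 ^ 2 - p.1 ^ 2) ^ (ν - 1) * h p.2)) p

theorem fracKernel_eq_indicator_Ioi (s ν : ℝ) (h : ℝ → ℝ) (r : ℝ) :
    (fun w => fracKernel s ν h (r, w)) =
      (Ioi r).indicator fun w => r ^ (s - 1) * (w * (w ^ 2 - r ^ 2) ^ (ν - 1) * h w) := by
  ext w
  simp only [fracKernel, indicator, mem_ofPred_eq, mem_Ioi]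

theorem fracKernel_eq_indicator_Iio (s ν : ℝ) (h : ℝ → ℝ) (w : ℝ) :
    (fun r => fracKernel s ν h (r, w)) =
      (Iio w).indicator fun r => w * h w * (r ^ (s - 1) * (w ^ 2 - r ^ 2) ^ (ν - 1)) := by
  ext r
  simp only [fracKernel, indicator, mem_ofPred_eq, mem_Iio]
  split_ifs
  · ring
  · rfl

theorem integral_fracKernel_left {s ν w : ℝ} (hs : 0 < s) (hν : 0 < ν) (h : ℝ → ℝ) (hw : 0 < w) :
    IntegrableOn (fun r => fracKernel s ν h (r, w)) (Ioi 0) ∧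
    ∫ r in Ioi (0 : ℝ), fracKernel s ν h (r, w)
      = ProbabilityTheory.beta (s / 2) ν / 2 * (w ^ (s + 2 * ν - 1) * h w) := by
  obtain ⟨h1, h2⟩ := integral_rpow_mul_sq_sub_sq_rpow hs hν hw
  rw [fracKernel_eq_indicator_Iio]
  constructor
  · rw [integrableOn_indicator_iff measurableSet_Iio, inter_comm, Ioi_inter_Iio]
    exact h1.const_mul _
  · rw [setIntegral_indicator measurableSet_Iio, Ioi_inter_Iio, integral_const_mul, h2,
      show s + 2 * ν - 1 = s + 2 * ν - 2 + 1 by ring, Real.rpow_add_one hw.ne']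
    ring

theorem integrable_fracKernel {s ν : ℝ} (hs : 0 < s) (hν : 0 < ν) {h : ℝ → ℝ} (hm : Measurable h)
    (hint : IntegrableOn (fun w => w ^ (s + 2 * ν - 1) * h w) (Ioi 0)) :
    Integrable (fracKernel s ν h)
      ((volume.restrict (Ioi (0 : ℝ))).prod (volume.restrict (Ioi (0 : ℝ)))) := by
  have hmeas : Measurable (fracKernel s ν h) :=
    Measurable.indicator (by fun_prop) (measurableSet_lt measurable_fst measurable_snd)
  rw [integrable_prod_iff' hmeas.aestronglyMeasurable]
  constructor
  · filter_upwards [ae_restrict_mem measurableSet_Ioi] with w hw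
    exact (integral_fracKernel_left hs hν h hw).1
  · refine (integrableOn_congr_fun (fun w hw => ?_) measurableSet_Ioi).1
      (hint.norm.const_mul (ProbabilityTheory.beta (s / 2) ν / 2))
    have hw0 : (0 : ℝ) < w := hw
    have e := (integral_fracKernel_left hs hν (fun w => |h w|) hw).2
    simp only [norm_mul]
    rw [Real.norm_of_nonneg (Real.rpow_nonneg hw0.le _), Real.norm_eq_abs, ← e]
    refine setIntegral_congr_fun measurableSet_Ioi fun r hr => ?_
    have hr0 : (0 : ℝ) < r := hr
    simp only [fracKernel, indicator, mem_ofPred_eq]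
    split_ifs with hlt
    · rw [norm_mul, norm_mul, norm_mul, Real.norm_of_nonneg (Real.rpow_nonneg hr0.le _),
        Real.norm_of_nonneg hw0.le, Real.norm_of_nonneg (Real.rpow_nonneg (by nlinarith) _),
        Real.norm_eq_abs]
    · simp

theorem integral_fracKernel_right (s ν : ℝ) (h : ℝ → ℝ) {r : ℝ} (hr : 0 < r) :
    ∫ w in Ioi (0 : ℝ), fracKernel s ν h (r, w) = r ^ (s - 1) * fracIntegral ν h r := by
  rw [fracKernel_eq_indicator_Ioi, setIntegral_indicator measurableSet_Ioi, Ioi_inter_Ioi,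
    sup_eq_right.2 hr.le, integral_const_mul, fracIntegral]

/-- Fubini yields convergence for almost every `r` only; this is what later permits the fractional
integral of a difference to be split. -/
theorem ae_integrableOn_fracIntegral {s ν : ℝ} (hs : 0 < s) (hν : 0 < ν) {h : ℝ → ℝ}
    (hm : Measurable h) (hint : IntegrableOn (fun w => w ^ (s + 2 * ν - 1) * h w) (Ioi 0)) :
    ∀ᵐ r ∂volume.restrict (Ioi (0 : ℝ)),
      IntegrableOn (fun w => w * (w ^ 2 - r ^ 2) ^ (ν - 1) * h w) (Ioi r) := by
  filter_upwards [(integrable_fracKernel hs hν hm hint).prod_right_ae,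
    ae_restrict_mem measurableSet_Ioi] with r hr hr0
  have hr0 : (0 : ℝ) < r := hr0
  rw [fracKernel_eq_indicator_Ioi] at hr
  have hr' : IntegrableOn ((Ioi r).indicator fun w => r ^ (s - 1) *
    (w * (w ^ 2 - r ^ 2) ^ (ν - 1) * h w)) (Ioi (0 : ℝ)) := hr
  rw [integrableOn_indicator_iff measurableSet_Ioi, Ioi_inter_Ioi,
    sup_eq_left.2 hr0.le] at hr'
  refine (hr'.const_mul (r ^ (s - 1))⁻¹).congr (Filter.Eventually.of_forall fun w => ?_)
  have := (Real.rpow_pos_of_pos hr0 (s - 1)).ne'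
  simp only
  field_simp

theorem integrableOn_rpow_mul_fracIntegral {s ν : ℝ} (hs : 0 < s) (hν : 0 < ν) {h : ℝ → ℝ}
    (hm : Measurable h) (hint : IntegrableOn (fun w => w ^ (s + 2 * ν - 1) * h w) (Ioi 0)) :
    IntegrableOn (fun r => r ^ (s - 1) * fracIntegral ν h r) (Ioi 0) :=
  (integrableOn_congr_fun (fun _ hr => integral_fracKernel_right s ν h hr) measurableSet_Ioi).1
    (integrable_fracKernel hs hν hm hint).integral_prod_left

theorem integral_rpow_mul_fracIntegral {s ν : ℝ} (hs : 0 < s) (hν : 0 < ν) {h : ℝ → ℝ}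
    (hm : Measurable h) (hint : IntegrableOn (fun w => w ^ (s + 2 * ν - 1) * h w) (Ioi 0)) :
    ∫ r in Ioi (0 : ℝ), r ^ (s - 1) * fracIntegral ν h r
      = ProbabilityTheory.beta (s / 2) ν / 2 * ∫ w in Ioi (0 : ℝ), w ^ (s + 2 * ν - 1) * h w := by
  rw [← integral_const_mul, ← setIntegral_congr_fun measurableSet_Ioi
    fun w hw => (integral_fracKernel_left hs hν h hw).2,
    ← setIntegral_congr_fun measurableSet_Ioi fun r hr => integral_fracKernel_right s ν h hr]
  exact integral_integral_swap (f := fun r w => fracKernel s ν h (r, w))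
    (integrable_fracKernel hs hν hm hint)

theorem abs_fracIntegral_le (ν : ℝ) (h : ℝ → ℝ) {r : ℝ} (hr : 0 < r) :
    |fracIntegral ν h r| ≤ fracIntegral ν (fun w => |h w|) r := by
  rw [fracIntegral, fracIntegral, ← Real.norm_eq_abs]
  refine (norm_integral_le_integral_norm _).trans_eq
    (setIntegral_congr_fun measurableSet_Ioi fun w hw => ?_)
  have hw : r < w := hw
  rw [norm_mul, norm_mul, Real.norm_of_nonneg (by linarith),
    Real.norm_of_nonneg (Real.rpow_nonneg (by nlinarith) _), Real.norm_eq_abs]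

theorem integral_rpow_mul_abs_fracIntegral_le {s ν : ℝ} (hs : 0 < s) (hν : 0 < ν) {h : ℝ → ℝ}
    (hm : Measurable h) (hint : IntegrableOn (fun w => w ^ (s + 2 * ν - 1) * h w) (Ioi 0)) :
    ∫ r in Ioi (0 : ℝ), r ^ (s - 1) * |fracIntegral ν h r|
      ≤ ProbabilityTheory.beta (s / 2) ν / 2 *
        ∫ w in Ioi (0 : ℝ), w ^ (s + 2 * ν - 1) * |h w| := by
  have hint' : IntegrableOn (fun w => w ^ (s + 2 * ν - 1) * |h w|) (Ioi 0) := by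
    refine (integrableOn_congr_fun (fun w hw => ?_) measurableSet_Ioi).1 hint.norm
    rw [norm_mul, Real.norm_of_nonneg (Real.rpow_nonneg (le_of_lt hw) _), Real.norm_eq_abs]
  rw [← integral_rpow_mul_fracIntegral hs hν (h := fun w => |h w|) (by fun_prop) hint']
  refine setIntegral_mono_on ?_ (integrableOn_rpow_mul_fracIntegral hs hν (by fun_prop) hint')
    measurableSet_Ioi fun r hr => ?_
  · refine (integrableOn_congr_fun (fun w hw => ?_) measurableSet_Ioi).1
      (integrableOn_rpow_mul_fracIntegral hs hν hm hint).norm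
    rw [norm_mul, Real.norm_of_nonneg (Real.rpow_nonneg (le_of_lt hw) _), Real.norm_eq_abs]
  · exact mul_le_mul_of_nonneg_left (abs_fracIntegral_le ν h hr)
      (Real.rpow_nonneg (le_of_lt hr) _)

/-! ### Moments and spectral density of the generalized Wendland functions. -/

/-- The truncated power `w ↦ (1 - w / δ)_+ ^ μ`. -/
def askey (δ μ w : ℝ) : ℝ := max 0 (1 - w / δ) ^ μ

theorem measurable_askey (δ μ : ℝ) : Measurable (askey δ μ) := by
  unfold askey
  fun_prop

theorem askey_nonneg (δ μ w : ℝ) : 0 ≤ askey δ μ w := Real.rpow_nonneg (le_max_left _ _) _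

theorem askey_of_le {δ μ w : ℝ} (hδ : 0 < δ) (hw : w ≤ δ) : askey δ μ w = (1 - w / δ) ^ μ := by
  rw [askey, max_eq_right (by rw [sub_nonneg]; exact (div_le_one hδ).2 hw)]

theorem askey_of_ge {δ μ w : ℝ} (hδ : 0 < δ) (hμ : 0 < μ) (hw : δ ≤ w) : askey δ μ w = 0 := by
  rw [askey, max_eq_left (by rw [sub_nonpos]; exact (one_le_div hδ).2 hw), Real.zero_rpow hμ.ne']

theorem integral_rpow_mul_askey {s δ μ : ℝ} (hs : 0 < s) (hδ : 0 < δ) (hμ : 0 < μ) :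
    IntegrableOn (fun w => w ^ (s - 1) * askey δ μ w) (Ioi 0) ∧
    ∫ w in Ioi (0 : ℝ), w ^ (s - 1) * askey δ μ w
      = δ ^ s * ProbabilityTheory.beta s (μ + 1) := by
  obtain ⟨h1, h2⟩ := integral_beta_scaled hs (show 0 < μ + 1 by linarith) hδ
  have e : (fun w => w ^ (s - 1) * askey δ μ w)
      =ᵐ[volume.restrict (Ioi 0)] (Ioo 0 δ).indicator
        (fun x : ℝ => x ^ (s - 1) * (1 - x / δ) ^ (μ + 1 - 1)) := by
    filter_upwards [ae_restrict_mem measurableSet_Ioi] with w hw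
    have hw : 0 < w := hw
    rcases lt_or_ge w δ with hlt | hge
    · rw [indicator_of_mem (show w ∈ Ioo 0 δ from ⟨hw, hlt⟩), askey_of_le hδ hlt.le,
        add_sub_cancel_right]
    · rw [indicator_of_notMem (fun h => not_lt.2 hge h.2), askey_of_ge hδ hμ hge, mul_zero]
  have hsub : Ioi (0 : ℝ) ∩ Ioo 0 δ = Ioo 0 δ := inter_eq_self_of_subset_right fun x hx => hx.1
  constructor
  · rw [IntegrableOn, integrable_congr e, ← IntegrableOn,
      integrableOn_indicator_iff measurableSet_Ioo, inter_comm, hsub]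
    exact h1
  · rw [integral_congr_ae e, setIntegral_indicator measurableSet_Ioo, hsub, h2]

theorem genWendland_zero {δ μ r : ℝ} (hδ : 0 < δ) (hμ : 0 < μ) :
    genWendland 0 μ δ r = askey δ μ r := by
  rw [genWendland]
  split_ifs with h h'
  · rw [askey_of_le hδ h]
  · simp at h'
  · rw [askey_of_ge hδ hμ (not_le.1 h).le]

/-- The substitution `u = w / δ`: one factor `δ` comes from `u`, one from `du` and `δ ^ (2 * (ν -
1))` from the kernel, whence `δ ^ (-(2 * ν))`. -/
theorem genWendland_of_pos {ν δ μ r : ℝ} (hν : 0 < ν) (hδ : 0 < δ) (hμ : 0 < μ) (hr : 0 < r) :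
    genWendland ν μ δ r = δ ^ (-(2 * ν)) / ProbabilityTheory.beta (2 * ν) (μ + 1) *
      fracIntegral ν (askey δ μ) r := by
  rw [genWendland, if_neg hν.ne']
  split_ifs with h
  · have e1 : fracIntegral ν (askey δ μ) r
        = ∫ w in r..δ, w * (w ^ 2 - r ^ 2) ^ (ν - 1) * (1 - w / δ) ^ μ := by
      rw [fracIntegral, intervalIntegral.integral_of_le h]
      have e : EqOn (fun w => w * (w ^ 2 - r ^ 2) ^ (ν - 1) * askey δ μ w)
          ((Ioc r δ).indicator fun w => w * (w ^ 2 - r ^ 2) ^ (ν - 1) * (1 - w / δ) ^ μ)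
          (Ioi r) := by
        intro w hw
        have hw : r < w := hw
        rcases le_or_gt w δ with hle | hgt
        · rw [indicator_of_mem (show w ∈ Ioc r δ from ⟨hw, hle⟩)]
          simp only [askey_of_le hδ hle]
        · rw [indicator_of_notMem (fun h => not_le.2 hgt h.2)]
          simp only [askey_of_ge hδ hμ hgt.le, mul_zero]
      rw [setIntegral_congr_fun measurableSet_Ioi e, setIntegral_indicator measurableSet_Ioc,
        inter_eq_self_of_subset_right fun x hx => hx.1]
    have e2 := intervalIntegral.integral_comp_div (a := r) (b := δ)
      (fun u => u * (u ^ 2 - (r / δ) ^ 2) ^ (ν - 1) * (1 - u) ^ μ) hδ.ne'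
    rw [div_self hδ.ne', smul_eq_mul] at e2
    have e3 : ∫ w in r..δ, w * (w ^ 2 - r ^ 2) ^ (ν - 1) * (1 - w / δ) ^ μ
        = δ ^ (2 * ν - 1) *
          ∫ x in r..δ, x / δ * ((x / δ) ^ 2 - (r / δ) ^ 2) ^ (ν - 1) * (1 - x / δ) ^ μ := by
      rw [← intervalIntegral.integral_const_mul]
      refine intervalIntegral.integral_congr fun w hw => ?_
      rw [uIcc_of_le h] at hw
      have hsq : 0 ≤ w ^ 2 - r ^ 2 := by nlinarith [hw.1]
      rw [show (w / δ) ^ 2 - (r / δ) ^ 2 = (w ^ 2 - r ^ 2) / δ ^ 2 by field_simp,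
        Real.div_rpow hsq (by positivity), ← Real.rpow_natCast δ 2, ← Real.rpow_mul hδ.le]
      have : δ ^ (2 * ν - 1) = δ ^ (((2 : ℕ) : ℝ) * (ν - 1)) * δ := by
        rw [← Real.rpow_add_one hδ.ne']
        congr 1
        push_cast
        ring
      rw [this]
      have := (Real.rpow_pos_of_pos hδ (((2 : ℕ) : ℝ) * (ν - 1))).ne'
      field_simp
    rw [e1, e3, e2, Real.rpow_sub_one hδ.ne', Real.rpow_neg hδ.le]
    have := (Real.rpow_pos_of_pos hδ (2 * ν)).ne'
    generalize (∫ u in (r / δ)..1, u * (u ^ 2 - (r / δ) ^ 2) ^ (ν - 1) * (1 - u) ^ μ) = I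
    field_simp
  · have : fracIntegral ν (askey δ μ) r = 0 := by
      rw [fracIntegral]
      refine setIntegral_eq_zero_of_forall_eq_zero fun w hw => ?_
      have hw : r < w := hw
      rw [askey_of_ge hδ hμ (by linarith), mul_zero]
    rw [this, mul_zero]

theorem integral_rpow_mul_genWendland {s ν δ μ : ℝ} (hs : 0 < s) (hν : 0 ≤ ν) (hδ : 0 < δ)
    (hμ : 0 < μ) :
    IntegrableOn (fun r => r ^ (s - 1) * genWendland ν μ δ r) (Ioi 0) ∧
    ∫ r in Ioi (0 : ℝ), r ^ (s - 1) * genWendland ν μ δ r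
      = δ ^ s * (Real.Gamma (s / 2) * gammaRatio ν * Real.Gamma (s + 2 * ν) *
        Real.Gamma (μ + 2 * ν + 1) /
        (2 * Real.Gamma (s / 2 + ν) * Real.Gamma (s + 2 * ν + μ + 1))) := by
  rcases hν.eq_or_lt with rfl | hν
  · obtain ⟨h1, h2⟩ := integral_rpow_mul_askey hs hδ hμ
    simp only [genWendland_zero hδ hμ]
    refine ⟨h1, ?_⟩
    have := (Real.Gamma_pos_of_pos (half_pos hs)).ne'
    -- The value 2 of `gammaRatio` at 0 cancels the 2 in the denominator, which leaves the Beta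
    -- integral.
    simp only [h2, ProbabilityTheory.beta, gammaRatio, if_true, mul_zero, add_zero]
    rw [← add_assoc]
    field_simp
  · obtain ⟨h1, h2⟩ := integral_rpow_mul_askey (show 0 < s + 2 * ν by linarith) hδ hμ
    have hcongr : EqOn (fun r => δ ^ (-(2 * ν)) / ProbabilityTheory.beta (2 * ν) (μ + 1) *
        (r ^ (s - 1) * fracIntegral ν (askey δ μ) r))
        (fun r => r ^ (s - 1) * genWendland ν μ δ r) (Ioi 0) := by
      intro r hr
      simp only [genWendland_of_pos hν hδ hμ hr]
      ring
    have hm := measurable_askey δ μ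
    refine ⟨(integrableOn_congr_fun hcongr measurableSet_Ioi).1
      ((integrableOn_rpow_mul_fracIntegral hs hν hm h1).const_mul _), ?_⟩
    rw [← setIntegral_congr_fun measurableSet_Ioi hcongr, integral_const_mul,
      integral_rpow_mul_fracIntegral hs hν hm h1, h2, Real.rpow_add hδ, Real.rpow_neg hδ.le,
      gammaRatio, if_neg hν.ne']
    simp only [ProbabilityTheory.beta]
    have p1 := (Real.rpow_pos_of_pos hδ (2 * ν)).ne'
    have p2 := (Real.Gamma_pos_of_pos (show 0 < μ + 1 by linarith)).ne'
    have p3 := (Real.Gamma_pos_of_pos (show 0 < μ + 2 * ν + 1 by linarith)).ne'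
    have p4 := (Real.Gamma_pos_of_pos (show 0 < 2 * ν by linarith)).ne'
    have p5 := (Real.Gamma_pos_of_pos (show 0 < s / 2 + ν by linarith)).ne'
    have p6 := (Real.Gamma_pos_of_pos (show 0 < s + 2 * ν + μ + 1 by linarith)).ne'
    rw [show 2 * ν + (μ + 1) = μ + 2 * ν + 1 by ring,
      show s + 2 * ν + (μ + 1) = s + 2 * ν + μ + 1 by ring]
    field_simp

theorem Gamma_add_natCast {x : ℝ} (hx : 0 < x) (k : ℕ) :
    Real.Gamma (k + x) = (ascPochhammer ℝ k).eval x * Real.Gamma x := by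
  induction k with
  | zero => simp
  | succ k ih =>
    have h0 : (k : ℝ) + x ≠ 0 := by positivity
    rw [show ((k + 1 : ℕ) : ℝ) + x = (k + x) + 1 by push_cast; ring, Real.Gamma_add_one h0, ih,
      ascPochhammer_succ_eval]
    ring

theorem Gamma_two_mul_add_natCast {x : ℝ} (hx : 0 < x) (k : ℕ) :
    Real.Gamma (2 * k + 2 * x) = 2 ^ (2 * k) * (ascPochhammer ℝ k).eval x *
      (ascPochhammer ℝ k).eval (x + 1 / 2) * Real.Gamma (2 * x) := by
  induction k with
  | zero => simp
  | succ k ih =>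
    have h0 : (2 : ℝ) * k + 2 * x ≠ 0 := by positivity
    have h1 : (2 : ℝ) * k + 2 * x + 1 ≠ 0 := by positivity
    rw [show (2 : ℝ) * ((k + 1 : ℕ) : ℝ) + 2 * x = (2 * k + 2 * x + 1) + 1 by push_cast; ring,
      Real.Gamma_add_one h1, Real.Gamma_add_one h0, ih,
      ascPochhammer_succ_eval, ascPochhammer_succ_eval]
    ring

theorem integrableOn_genWendland {d : ℕ} (hd : 1 ≤ d) {ν δ μ : ℝ} (hν : 0 ≤ ν) (hδ : 0 < δ)
    (hμ : 0 < μ) : IntegrableOn (fun r => genWendland ν μ δ r * r ^ (d - 1)) (Ioi 0) := by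
  have hd0 : (0 : ℝ) < d := by exact_mod_cast hd
  refine (integral_rpow_mul_genWendland hd0 hν hδ hμ).1.congr (Filter.Eventually.of_forall
    fun r => ?_)
  simp only
  rw [← Real.rpow_natCast, Nat.cast_sub hd, Nat.cast_one, mul_comm]

theorem spectralDensity_genWendland {d : ℕ} (hd : 1 ≤ d) {ν δ μ : ℝ} (hν : 0 ≤ ν) (hδ : 0 < δ)
    (hμ : 0 < μ) {z : ℝ} (hz : 0 < z) :
    spectralDensity d (genWendland ν μ δ) z = genWendlandDensity d ν μ δ z := by
  have hd0 : (0 : ℝ) < d := by exact_mod_cast hd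
  have hsum := hasSum_integral_besselEntire_of_eq_zero (a := (d : ℝ) / 2 - 1) (by linarith) z
    (R := δ) (integrableOn_genWendland hd hν hδ hμ) (fun u hu => by
      rw [genWendland, if_neg (not_le.2 hu), zero_mul])
  rw [spectralDensity_eq_integral_besselEntire hd _ hz, ← hsum.tsum_eq, genWendlandDensity,
    hypergeometric1F2, ← tsum_mul_left, ← tsum_mul_left]
  refine tsum_congr fun k => ?_
  have hs : (0 : ℝ) < 2 * k + d := by positivity
  have hmom : ∫ u in Ioi (0 : ℝ), u ^ (2 * k) * (genWendland ν μ δ u * u ^ (d - 1))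
      = ∫ r in Ioi (0 : ℝ), r ^ ((2 * k + d : ℝ) - 1) * genWendland ν μ δ r := by
    refine setIntegral_congr_fun measurableSet_Ioi fun u hu => ?_
    have hu : 0 < u := hu
    have : u ^ ((2 * k + d : ℝ) - 1) = u ^ (2 * k) * u ^ (d - 1) := by
      rw [← pow_add, ← Real.rpow_natCast]
      congr 1
      push_cast [Nat.cast_sub hd]
      ring
    simp only [this]
    ring
  rw [hmom, (integral_rpow_mul_genWendland hs hν hδ hμ).2]
  have hlam : 0 < lam d ν := by unfold lam; positivity
  have ha : 0 < ν + (d : ℝ) / 2 := by positivity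
  have hb : 0 < lam d ν + μ / 2 := by positivity
  -- Duplication splits each `Γ(2k + ·)` into two Pochhammer symbols. The symbol of `ν + d / 2` in
  -- `g1` cancels the one in `g3`, and the powers of 4 in `g1` and `g2` cancel; the ₁F₂ coefficient
  -- remains.
  have g1 := Gamma_two_mul_add_natCast ha k
  have g2 := Gamma_two_mul_add_natCast hb k
  have g3 := Gamma_add_natCast ha k
  rw [show ν + (d : ℝ) / 2 + 1 / 2 = lam d ν by unfold lam; ring,
    show 2 * (ν + (d : ℝ) / 2) = 2 * ν + d by ring] at g1
  rw [show lam d ν + μ / 2 + 1 / 2 = lam d ν + (μ + 1) / 2 by ring,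
    show 2 * (lam d ν + μ / 2) = μ + 2 * ν + d + 1 by unfold lam; ring] at g2
  rw [show (2 * k + d : ℝ) / 2 + ν = k + (ν + (d : ℝ) / 2) by ring, g3,
    show (2 * k + d : ℝ) + 2 * ν + μ + 1 = 2 * k + (μ + 2 * ν + d + 1) by ring, g2,
    show (2 * k + d : ℝ) + 2 * ν = 2 * k + (2 * ν + d) by ring, g1,
    show (k : ℝ) + ((d : ℝ) / 2 - 1) + 1 = (2 * k + d) / 2 by ring]
  have p1 := (Real.Gamma_pos_of_pos (half_pos hs)).ne'
  have p2 := (Real.Gamma_pos_of_pos ha).ne'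
  have p3 := (Real.Gamma_pos_of_pos (show 0 < μ + 2 * ν + d + 1 by linarith)).ne'
  have p4 := (ascPochhammer_pos k (ν + (d : ℝ) / 2) ha).ne'
  have p5 := (ascPochhammer_pos k (lam d ν + μ / 2) hb).ne'
  have p6 := (ascPochhammer_pos k (lam d ν + (μ + 1) / 2) (by positivity)).ne'
  have c2 : δ ^ (2 * k + d : ℝ) = (δ ^ 2) ^ k * δ ^ d := by
    rw [← pow_mul, ← pow_add, ← Real.rpow_natCast]
    push_cast
    rfl
  have c3 : (-(z * δ) ^ 2 / 4) ^ k = (-1) ^ k * (z / 2) ^ (2 * k) * (δ ^ 2) ^ k := by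
    rw [pow_mul, ← mul_pow, ← mul_pow]
    congr 1
    ring
  rw [two_rpow_div_two_mul_pi_rpow, c2, c3]
  generalize (ascPochhammer ℝ k).eval (ν + (d : ℝ) / 2) = A at p4 ⊢
  generalize (ascPochhammer ℝ k).eval (lam d ν + μ / 2) = B at p5 ⊢
  generalize (ascPochhammer ℝ k).eval (lam d ν + (μ + 1) / 2) = C at p6 ⊢
  field_simp

theorem delta_pos {ν μ β : ℝ} (hν : 0 ≤ ν) (hμ : 0 < μ) (hβ : 0 < β) : 0 < delta ν μ β := by
  have h1 := Real.Gamma_pos_of_pos hμ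
  have h2 := Real.Gamma_pos_of_pos (show 0 < μ + 2 * ν + 1 by linarith)
  unfold delta
  positivity

/-! ### The Matérn function as a mixture of Gaussians, and its spectral density. -/

/-- The integral `∫_0^∞ s^{a-1} exp(-s - x²/(4s)) ds`, which is `2 (x/2)^a K_a(x)`. -/
def maternIntegral (a x : ℝ) : ℝ :=
  ∫ s in Ioi (0 : ℝ), s ^ (a - 1) * Real.exp (-s) * Real.exp (-(x ^ 2 / (4 * s)))

theorem integrableOn_rpow_mul_exp_neg {a : ℝ} (ha : 0 < a) :
    IntegrableOn (fun s : ℝ => s ^ (a - 1) * Real.exp (-s)) (Ioi 0) := by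
  simpa using integrableOn_rpow_mul_exp_neg_rpow (p := 1) (s := a - 1) (by linarith) one_pos

theorem integrableOn_maternIntegral {a : ℝ} (ha : 0 < a) (x : ℝ) :
    IntegrableOn (fun s : ℝ => s ^ (a - 1) * Real.exp (-s) * Real.exp (-(x ^ 2 / (4 * s))))
      (Ioi 0) := by
  refine (integrableOn_rpow_mul_exp_neg ha).mono' (by fun_prop) ?_
  filter_upwards [ae_restrict_mem measurableSet_Ioi] with s hs
  have hs : 0 < s := hs
  rw [Real.norm_of_nonneg (by positivity)]
  refine mul_le_of_le_one_right (by positivity) (Real.exp_le_one_iff.2 ?_)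
  have : 0 ≤ x ^ 2 / (4 * s) := by positivity
  linarith

/-- The substitution `s = (x / 2) * exp t` turns `s + x² / (4 s)` into `x * cosh t`. -/
theorem besselK_eq_maternIntegral {a x : ℝ} (ha : 0 < a) (hx : 0 < x) :
    (x / 2) ^ a * besselK a x = maternIntegral a x / 2 := by
  have himg : (fun t : ℝ => x / 2 * Real.exp t) '' univ = Ioi 0 := by
    ext y
    constructor
    · rintro ⟨t, -, rfl⟩
      exact mul_pos (half_pos hx) (Real.exp_pos t)
    · intro hy
      have hy : 0 < y := hy
      refine ⟨Real.log (y / (x / 2)), mem_univ _, ?_⟩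
      simp only
      rw [Real.exp_log (by positivity)]
      field_simp
  have hd : ∀ t ∈ (univ : Set ℝ), HasDerivWithinAt (fun t : ℝ => x / 2 * Real.exp t)
      (x / 2 * Real.exp t) univ t := fun t _ =>
    ((Real.hasDerivAt_exp t).const_mul (x / 2)).hasDerivWithinAt
  have hinj : InjOn (fun t : ℝ => x / 2 * Real.exp t) univ := fun t _ u _ h =>
    Real.exp_injective (mul_left_cancel₀ (half_pos hx).ne' h)
  have hcongr : (fun t : ℝ => |x / 2 * Real.exp t| • ((x / 2 * Real.exp t) ^ (a - 1) *
      Real.exp (-(x / 2 * Real.exp t)) * Real.exp (-(x ^ 2 / (4 * (x / 2 * Real.exp t))))))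
      = fun t => (x / 2) ^ a * (Real.exp (-x * Real.cosh t) * Real.exp (a * t)) := by
    ext t
    have h0 : 0 < x / 2 * Real.exp t := by positivity
    rw [abs_of_pos h0, smul_eq_mul, Real.rpow_sub_one h0.ne', Real.mul_rpow (by positivity)
      (Real.exp_pos t).le, ← Real.exp_mul, mul_comm t a]
    have : Real.exp (-x * Real.cosh t) = Real.exp (-(x / 2 * Real.exp t)) *
        Real.exp (-(x ^ 2 / (4 * (x / 2 * Real.exp t)))) := by
      rw [← Real.exp_add, Real.cosh_eq, Real.exp_neg t]
      congr 1
      have := (Real.exp_pos t).ne'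
      field_simp
      ring
    rw [this]
    generalize Real.exp (-(x / 2 * Real.exp t)) = A
    generalize Real.exp (-(x ^ 2 / (4 * (x / 2 * Real.exp t)))) = B
    field_simp
  have hint := integrableOn_maternIntegral ha x
  rw [← himg, integrableOn_image_iff_integrableOn_abs_deriv_smul MeasurableSet.univ hd hinj,
    hcongr, integrableOn_univ] at hint
  have hint' : Integrable fun t : ℝ => Real.exp (-x * Real.cosh t) * Real.exp (a * t) := by
    refine (hint.const_mul ((x / 2) ^ a)⁻¹).congr (Filter.Eventually.of_forall fun t => ?_)
    have := (Real.rpow_pos_of_pos (half_pos hx) a).ne'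
    simp only
    field_simp
  have hval : maternIntegral a x
      = (x / 2) ^ a * ∫ t : ℝ, Real.exp (-x * Real.cosh t) * Real.exp (a * t) := by
    rw [maternIntegral, ← himg, integral_image_eq_integral_abs_deriv_smul MeasurableSet.univ hd
      hinj, hcongr, setIntegral_univ, integral_const_mul]
  rw [hval, mul_div_assoc]
  congr 1
  -- Folding the line at 0 replaces `exp (a * t)` by `2 * cosh (a * t)`.
  rw [← intervalIntegral.integral_Iic_add_Ioi (b := 0) hint'.integrableOn hint'.integrableOn,
    ← neg_zero, ← integral_comp_neg_Ioi, neg_zero, ← integral_add, besselK, ← integral_div]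
  · refine setIntegral_congr_fun measurableSet_Ioi fun t _ => ?_
    rw [Real.cosh_neg, Real.cosh_eq (a * t)]
    ring_nf
  · exact hint'.comp_neg.integrableOn
  · exact hint'.integrableOn

theorem matern_eq_maternIntegral {a β r : ℝ} (ha : 0 < a) (hβ : 0 < β) (hr : 0 < r) :
    matern a β r = maternIntegral a (r / β) / Real.Gamma a := by
  have h := besselK_eq_maternIntegral ha (div_pos hr hβ)
  rw [Real.div_rpow (by positivity) zero_le_two] at h
  rw [matern, if_neg hr.ne', Real.rpow_sub two_pos, Real.rpow_one]
  have h2 : (2 : ℝ) ^ a ≠ 0 := by positivity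
  have hG := (Real.Gamma_pos_of_pos ha).ne'
  rw [show maternIntegral a (r / β) = 2 * ((r / β) ^ a / 2 ^ a * besselK a (r / β)) by rw [h]; ring]
  ring

/-- Since `cosh t = 1 + 2 * sinh (t / 2) ^ 2`, the substitution `y = sinh (t / 2)` reduces the
Bessel integral of order 1/2 to a Gaussian one. -/
theorem maternIntegral_half {x : ℝ} (hx : 0 < x) :
    maternIntegral (1 / 2) x = √Real.pi * Real.exp (-x) := by
  have himg : (fun t : ℝ => Real.sinh (t / 2)) '' Ioi 0 = Ioi 0 := by
    ext y
    constructor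
    · rintro ⟨t, ht, rfl⟩
      exact Real.sinh_pos_iff.2 (half_pos ht)
    · intro hy
      refine ⟨2 * Real.arsinh y, mul_pos two_pos (Real.arsinh_pos_iff.2 hy), ?_⟩
      simp
  have hd : ∀ t ∈ Ioi (0 : ℝ), HasDerivWithinAt (fun t : ℝ => Real.sinh (t / 2))
      (Real.cosh (t / 2) * (1 / 2)) (Ioi 0) t := fun t _ =>
    (((hasDerivAt_id t).div_const 2).sinh).hasDerivWithinAt
  have hinj : InjOn (fun t : ℝ => Real.sinh (t / 2)) (Ioi 0) := fun t _ u _ h => by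
    have := Real.sinh_injective h
    linarith
  have hg := integral_gaussian_Ioi (2 * x)
  have hK : besselK (1 / 2) x = Real.exp (-x) * √(Real.pi / (2 * x)) := by
    have e : besselK (1 / 2) x = 2 * Real.exp (-x) *
        ∫ y in (fun t : ℝ => Real.sinh (t / 2)) '' Ioi 0, Real.exp (-(2 * x) * y ^ 2) := by
      rw [integral_image_eq_integral_abs_deriv_smul measurableSet_Ioi hd hinj, besselK,
        ← integral_const_mul]
      refine setIntegral_congr_fun measurableSet_Ioi fun t _ => ?_
      have hc : Real.cosh t = 1 + 2 * Real.sinh (t / 2) ^ 2 := by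
        have h1 := Real.cosh_two_mul (t / 2)
        rw [mul_div_cancel₀ t two_ne_zero] at h1
        rw [h1, Real.cosh_sq]
        ring
      have h2 : Real.exp (-x * Real.cosh t)
          = Real.exp (-x) * Real.exp (-(2 * x) * Real.sinh (t / 2) ^ 2) := by
        rw [← Real.exp_add, hc]
        congr 1
        ring
      simp only [smul_eq_mul]
      rw [h2, abs_of_pos (by have := Real.cosh_pos (t / 2); positivity),
        show 1 / 2 * t = t / 2 by ring]
      ring
    rw [e, himg, hg]
    ring
  have h := besselK_eq_maternIntegral (a := 1 / 2) (by norm_num) hx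
  rw [hK, ← Real.sqrt_eq_rpow] at h
  have h3 : √(x / 2) * √(Real.pi / (2 * x)) = √Real.pi / 2 := by
    rw [← Real.sqrt_mul (by positivity), show x / 2 * (Real.pi / (2 * x)) = Real.pi / 2 ^ 2 by
      field_simp, Real.sqrt_div Real.pi_pos.le, Real.sqrt_sq two_pos.le]
  linear_combination (-2) * h + 2 * Real.exp (-x) * h3

theorem integral_rpow_mul_gaussian {s c : ℝ} (hs : 0 < s) (hc : 0 < c) :
    IntegrableOn (fun u : ℝ => u ^ (s - 1) * Real.exp (-(u ^ 2 / (4 * c)))) (Ioi 0) ∧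
    ∫ u in Ioi (0 : ℝ), u ^ (s - 1) * Real.exp (-(u ^ 2 / (4 * c)))
      = (4 * c) ^ (s / 2) * Real.Gamma (s / 2) / 2 := by
  have hb : 0 < 1 / (4 * c) := by positivity
  have e : (fun u : ℝ => u ^ (s - 1) * Real.exp (-(u ^ 2 / (4 * c))))
      = fun u : ℝ => u ^ (s - 1) * Real.exp (-(1 / (4 * c)) * u ^ (2 : ℝ)) := by
    ext u
    rw [Real.rpow_two]
    congr 2
    ring
  rw [e]
  refine ⟨integrableOn_rpow_mul_exp_neg_mul_rpow (by linarith) two_pos hb, ?_⟩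
  rw [integral_rpow_mul_exp_neg_mul_rpow two_pos (by linarith) hb, sub_add_cancel, neg_div,
    one_div (4 * c), Real.inv_rpow (by positivity), Real.rpow_neg (by positivity), inv_inv]
  ring

/-- The Gaussian moments cancel the Gamma factors of the Bessel series, and an exponential series is
left. -/
theorem integral_besselEntire_mul_gaussian {d : ℕ} (hd : 1 ≤ d) {c : ℝ} (hc : 0 < c) (z : ℝ) :
    ∫ u in Ioi (0 : ℝ), besselEntire ((d : ℝ) / 2 - 1) (u * z) *
      (u ^ ((d : ℝ) - 1) * Real.exp (-(u ^ 2 / (4 * c))))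
      = (4 * c) ^ ((d : ℝ) / 2) / 2 * Real.exp (-(z ^ 2 * c)) := by
  have hd0 : (0 : ℝ) < d := by exact_mod_cast hd
  have hs : ∀ k : ℕ, (0 : ℝ) < 2 * k + d := fun k => by positivity
  have hcongr : ∀ k : ℕ, EqOn
      (fun u : ℝ => u ^ ((2 * k + d : ℝ) - 1) * Real.exp (-(u ^ 2 / (4 * c))))
      (fun u => u ^ (2 * k) * (u ^ ((d : ℝ) - 1) * Real.exp (-(u ^ 2 / (4 * c))))) (Ioi 0) := by
    intro k u hu
    have hu : 0 < u := hu
    simp only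
    rw [add_sub_assoc, Real.rpow_add hu, ← Real.rpow_natCast u (2 * k)]
    push_cast
    ring
  have hint : ∀ k : ℕ, IntegrableOn (fun u : ℝ => u ^ (2 * k) *
      (u ^ ((d : ℝ) - 1) * Real.exp (-(u ^ 2 / (4 * c))))) (Ioi 0) := fun k =>
    (integrableOn_congr_fun (hcongr k) measurableSet_Ioi).1
      (integral_rpow_mul_gaussian (hs k) hc).1
  have hmom : ∀ k : ℕ, ∫ u in Ioi (0 : ℝ), u ^ (2 * k) *
      (u ^ ((d : ℝ) - 1) * Real.exp (-(u ^ 2 / (4 * c))))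
      = (4 * c) ^ k * (4 * c) ^ ((d : ℝ) / 2) * Real.Gamma (k + (d : ℝ) / 2) / 2 := by
    intro k
    rw [← setIntegral_congr_fun measurableSet_Ioi (hcongr k),
      (integral_rpow_mul_gaussian (hs k) hc).2,
      show (2 * k + d : ℝ) / 2 = k + (d : ℝ) / 2 by ring, Real.rpow_add (by positivity),
      Real.rpow_natCast]
  have hG : ∀ k : ℕ, Real.Gamma (k + (d : ℝ) / 2) ≠ 0 := fun k =>
    (Real.Gamma_pos_of_pos (by positivity)).ne'
  have hexp : ∀ y : ℝ, HasSum (fun k : ℕ => y ^ k / (k.factorial : ℝ)) (Real.exp y) := by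
    intro y
    rw [Real.exp_eq_exp_ℝ]
    exact NormedSpace.expSeries_div_hasSum_exp y
  -- The sign is kept as a parameter: `e = 1` gives absolute summability, `e = -1` the sum itself.
  have hterm : ∀ (e : ℝ) (k : ℕ),
      e ^ k / ((k.factorial : ℝ) * Real.Gamma (k + ((d : ℝ) / 2 - 1) + 1)) * (z / 2) ^ (2 * k) *
      ((4 * c) ^ k * (4 * c) ^ ((d : ℝ) / 2) * Real.Gamma (k + (d : ℝ) / 2) / 2)
      = (4 * c) ^ ((d : ℝ) / 2) / 2 * ((e * (z ^ 2 * c)) ^ k / (k.factorial : ℝ)) := by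
    intro e k
    have h1 := hG k
    have h2 : (e * (z ^ 2 * c)) ^ k = e ^ k * (z / 2) ^ (2 * k) * (4 * c) ^ k := by
      rw [pow_mul, ← mul_pow, ← mul_pow]
      congr 1
      ring
    rw [show (k : ℝ) + ((d : ℝ) / 2 - 1) + 1 = k + (d : ℝ) / 2 by ring, h2]
    generalize Real.Gamma (k + (d : ℝ) / 2) = G at h1
    generalize (4 * c) ^ ((d : ℝ) / 2) = C
    field_simp
  have hsum := hasSum_integral_besselEntire (a := (d : ℝ) / 2 - 1) (by linarith) z hint (by
    refine ((hexp (1 * (z ^ 2 * c))).summable.mul_left ((4 * c) ^ ((d : ℝ) / 2) / 2)).congr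
      fun k => ?_
    rw [← hterm 1 k, ← hmom k, one_pow]
    congr 1
    refine setIntegral_congr_fun measurableSet_Ioi fun u hu => ?_
    have hu : 0 < u := hu
    rw [abs_of_pos (by positivity)])
  refine hsum.unique ?_
  rw [show -(z ^ 2 * c) = -1 * (z ^ 2 * c) by ring]
  refine ((hexp (-1 * (z ^ 2 * c))).mul_left _).congr_fun fun k => ?_
  rw [hmom k, hterm]

/-- The joint integrand of the radial moment of the Matérn function and its mixture. -/
def maternKernel (q a β : ℝ) (p : ℝ × ℝ) : ℝ :=
  p.1 ^ (q - 1) * (p.2 ^ (a - 1) * Real.exp (-p.2) * Real.exp (-((p.1 / β) ^ 2 / (4 * p.2))))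

theorem maternKernel_eq (q a β u s : ℝ) :
    maternKernel q a β (u, s) = s ^ (a - 1) * Real.exp (-s) *
      (u ^ (q - 1) * Real.exp (-(u ^ 2 / (4 * (β ^ 2 * s))))) := by
  rw [maternKernel, show (u / β) ^ 2 / (4 * s) = u ^ 2 / (4 * (β ^ 2 * s)) by
    rw [div_pow, div_div]; congr 1; ring]
  ring

theorem integrable_maternKernel {q a β : ℝ} (hq : 0 < q) (ha : 0 < a) (hβ : 0 < β) :
    Integrable (maternKernel q a β)
      ((volume.restrict (Ioi (0 : ℝ))).prod (volume.restrict (Ioi (0 : ℝ)))) := by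
  have hmeas : Measurable (maternKernel q a β) := by unfold maternKernel; fun_prop
  rw [integrable_prod_iff' hmeas.aestronglyMeasurable]
  constructor
  · filter_upwards [ae_restrict_mem measurableSet_Ioi] with s hs
    have hs : 0 < s := hs
    simp only [maternKernel_eq]
    exact (integral_rpow_mul_gaussian hq (show 0 < β ^ 2 * s by positivity)).1.const_mul _
  · refine (integrableOn_congr_fun (fun s hs => ?_) measurableSet_Ioi).1
      ((integrableOn_rpow_mul_exp_neg (show 0 < a + q / 2 by positivity)).const_mul
        ((4 * β ^ 2) ^ (q / 2) * Real.Gamma (q / 2) / 2))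
    have hs : 0 < s := hs
    have e : ∫ u in Ioi (0 : ℝ), ‖maternKernel q a β (u, s)‖ = ∫ u in Ioi (0 : ℝ),
        s ^ (a - 1) * Real.exp (-s) * (u ^ (q - 1) * Real.exp (-(u ^ 2 / (4 * (β ^ 2 * s))))) := by
      refine setIntegral_congr_fun measurableSet_Ioi fun u hu => ?_
      have hu : 0 < u := hu
      rw [maternKernel_eq, Real.norm_of_nonneg (by positivity)]
    rw [e, integral_const_mul, (integral_rpow_mul_gaussian hq (by positivity)).2,
      show 4 * (β ^ 2 * s) = 4 * β ^ 2 * s by ring, Real.mul_rpow (by positivity) hs.le,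
      show a + q / 2 - 1 = (a - 1) + q / 2 by ring, Real.rpow_add hs]
    ring

theorem integral_maternKernel {a β u : ℝ} (ha : 0 < a) (hβ : 0 < β) (hu : 0 < u) (q : ℝ) :
    ∫ s in Ioi (0 : ℝ), maternKernel q a β (u, s)
      = Real.Gamma a * (matern a β u * u ^ (q - 1)) := by
  have hG := (Real.Gamma_pos_of_pos ha).ne'
  rw [matern_eq_maternIntegral ha hβ hu, maternIntegral]
  simp only [maternKernel]
  rw [integral_const_mul, div_mul_eq_mul_div, mul_div_cancel₀ _ hG, mul_comm]

theorem integrableOn_matern {d : ℕ} (hd : 1 ≤ d) {a β : ℝ} (ha : 0 < a) (hβ : 0 < β) :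
    IntegrableOn (fun r => matern a β r * r ^ (d - 1)) (Ioi 0) := by
  have hd0 : (0 : ℝ) < d := by exact_mod_cast hd
  have hG := (Real.Gamma_pos_of_pos ha).ne'
  refine (integrableOn_congr_fun (fun u hu => ?_) measurableSet_Ioi).1
    ((integrable_maternKernel hd0 ha hβ).integral_prod_left.const_mul (Real.Gamma a)⁻¹)
  rw [integral_maternKernel ha hβ hu, ← Real.rpow_natCast, Nat.cast_sub hd, Nat.cast_one]
  field_simp

theorem spectralDensity_matern {d : ℕ} (hd : 1 ≤ d) {a β : ℝ} (ha : 0 < a) (hβ : 0 < β)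
    {z : ℝ} (hz : 0 < z) :
    spectralDensity d (matern a β) z = maternDensity d a β z := by
  have hd1 : (1 : ℝ) ≤ d := by exact_mod_cast hd
  have hd0 : (0 : ℝ) < d := by linarith
  have hG := (Real.Gamma_pos_of_pos ha).ne'
  rw [spectralDensity_eq_integral_besselEntire hd _ hz]
  have hb : Measurable (besselEntire ((d : ℝ) / 2 - 1)) := measurable_besselEntire (by linarith)
  -- The bound on the Bessel kernel preserves joint integrability, so the Gaussians can be
  -- transformed under the mixture.
  have hint : Integrable (fun p : ℝ × ℝ => besselEntire ((d : ℝ) / 2 - 1) (p.1 * z) *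
      maternKernel d a β p) ((volume.restrict (Ioi (0 : ℝ))).prod (volume.restrict (Ioi 0))) :=
    (integrable_maternKernel hd0 ha hβ).bdd_mul
      (hb.comp (by fun_prop : Measurable fun p : ℝ × ℝ => p.1 * z)).aestronglyMeasurable
      (Filter.Eventually.of_forall fun p =>
        abs_besselEntire_le (a := (d : ℝ) / 2 - 1) (by linarith) (p.1 * z))
  have e1 : ∫ u in Ioi (0 : ℝ), besselEntire ((d : ℝ) / 2 - 1) (u * z) *
        (matern a β u * u ^ (d - 1))
      = (Real.Gamma a)⁻¹ * ∫ u in Ioi (0 : ℝ), ∫ s in Ioi (0 : ℝ),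
        besselEntire ((d : ℝ) / 2 - 1) (u * z) * maternKernel d a β (u, s) := by
    rw [← integral_const_mul]
    refine setIntegral_congr_fun measurableSet_Ioi fun u hu => ?_
    rw [integral_const_mul, integral_maternKernel ha hβ hu, ← Real.rpow_natCast u (d - 1),
      Nat.cast_sub hd, Nat.cast_one]
    field_simp
  -- Transforming the Gaussian of parameter `s` raises the rate of `exp (-s)` from 1 to `1 + β² z²`
  -- and the power of `s` by `d / 2`: a Gamma integral in `s`.
  have e2 : ∀ s ∈ Ioi (0 : ℝ), ∫ u in Ioi (0 : ℝ),
      besselEntire ((d : ℝ) / 2 - 1) (u * z) * maternKernel d a β (u, s)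
      = (4 * β ^ 2) ^ ((d : ℝ) / 2) / 2 *
        (s ^ (a + (d : ℝ) / 2 - 1) * Real.exp (-((1 + β ^ 2 * z ^ 2) * s))) := by
    intro s hs
    have hs : 0 < s := hs
    simp only [maternKernel_eq, mul_left_comm (besselEntire _ _) (s ^ (a - 1) * Real.exp (-s))]
    rw [integral_const_mul, integral_besselEntire_mul_gaussian hd (by positivity),
      show 4 * (β ^ 2 * s) = 4 * β ^ 2 * s by ring, Real.mul_rpow (by positivity) hs.le,
      show a + (d : ℝ) / 2 - 1 = (a - 1) + (d : ℝ) / 2 by ring, Real.rpow_add hs,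
      show -((1 + β ^ 2 * z ^ 2) * s) = -s + -(z ^ 2 * (β ^ 2 * s)) by ring, Real.exp_add]
    ring
  have h4 : (4 * β ^ 2) ^ ((d : ℝ) / 2) = 2 ^ (d : ℝ) * β ^ d := by
    rw [show 4 * β ^ 2 = (2 * β) ^ (2 : ℝ) by rw [Real.rpow_two]; ring,
      ← Real.rpow_mul (by positivity), mul_div_cancel₀ _ two_ne_zero,
      Real.mul_rpow zero_le_two hβ.le, Real.rpow_natCast β d]
  rw [e1, integral_integral_swap (f := fun u s => besselEntire ((d : ℝ) / 2 - 1) (u * z) *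
    maternKernel d a β (u, s)) hint, setIntegral_congr_fun measurableSet_Ioi e2,
    integral_const_mul, Real.integral_rpow_mul_exp_neg_mul_Ioi (by positivity) (by positivity),
    two_rpow_div_two_mul_pi_rpow, h4, maternDensity, one_div, Real.inv_rpow (by positivity),
    Real.rpow_neg zero_le_two, neg_div, Real.rpow_neg Real.pi_pos.le]
  have h2 : (2 : ℝ) ^ (d : ℝ) ≠ 0 := by positivity
  generalize (2 : ℝ) ^ (d : ℝ) = A at h2
  generalize (1 + β ^ 2 * z ^ 2) ^ (a + (d : ℝ) / 2) = B
  generalize Real.Gamma (a + (d : ℝ) / 2) = C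
  generalize Real.pi ^ ((d : ℝ) / 2) = D
  field_simp

/-! ### The Matérn function as a fractional integral of the exponential. -/

/-- Gaussians are eigenfunctions of the fractional integral: put `v = w ^ 2 - r ^ 2`. -/
theorem integral_mul_sq_sub_sq_rpow_mul_exp {ν c r : ℝ} (hν : 0 < ν) (hc : 0 < c) (hr : 0 < r) :
    IntegrableOn (fun w : ℝ => w * (w ^ 2 - r ^ 2) ^ (ν - 1) * Real.exp (-(w ^ 2 / c))) (Ioi r) ∧
    ∫ w in Ioi r, w * (w ^ 2 - r ^ 2) ^ (ν - 1) * Real.exp (-(w ^ 2 / c))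
      = Real.Gamma ν * c ^ ν / 2 * Real.exp (-(r ^ 2 / c)) := by
  have himg : (fun w : ℝ => w ^ 2 - r ^ 2) '' Ioi r = Ioi 0 := by
    ext y
    constructor
    · rintro ⟨w, hw, rfl⟩
      have hw : r < w := hw
      have : 0 < w ^ 2 - r ^ 2 := by nlinarith
      exact this
    · intro hy
      have hy : 0 < y := hy
      refine ⟨√(y + r ^ 2), Real.lt_sqrt_of_sq_lt (by linarith), ?_⟩
      simp only
      rw [Real.sq_sqrt (by positivity)]
      ring
  have hd : ∀ w ∈ Ioi r, HasDerivWithinAt (fun w : ℝ => w ^ 2 - r ^ 2) (2 * w) (Ioi r) w := by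
    intro w _
    have := ((hasDerivAt_pow 2 w).sub_const (r ^ 2)).hasDerivWithinAt (s := Ioi r)
    simpa using this
  have hinj : InjOn (fun w : ℝ => w ^ 2 - r ^ 2) (Ioi r) := by
    intro x hx y hy h
    have hx : r < x := hx
    have hy : r < y := hy
    exact (pow_left_inj₀ (by linarith) (by linarith) two_ne_zero).1 (sub_left_injective h)
  have hcongr : EqOn (fun w : ℝ => Real.exp (-(r ^ 2 / c)) / 2 * (|2 * w| •
      ((w ^ 2 - r ^ 2) ^ (ν - 1) * Real.exp (-(1 / c * (w ^ 2 - r ^ 2))))))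
      (fun w : ℝ => w * (w ^ 2 - r ^ 2) ^ (ν - 1) * Real.exp (-(w ^ 2 / c))) (Ioi r) := by
    intro w hw
    have hw : r < w := hw
    simp only [smul_eq_mul]
    rw [abs_of_pos (by linarith),
      show -(w ^ 2 / c) = -(r ^ 2 / c) + -(1 / c * (w ^ 2 - r ^ 2)) by ring, Real.exp_add]
    ring
  have hi : IntegrableOn (fun v : ℝ => v ^ (ν - 1) * Real.exp (-(1 / c * v))) (Ioi 0) := by
    simpa using integrableOn_rpow_mul_exp_neg_mul_rpow (p := 1) (s := ν - 1) (b := 1 / c)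
      (by linarith) one_pos (by positivity)
  have hv := Real.integral_rpow_mul_exp_neg_mul_Ioi hν (show 0 < 1 / c by positivity)
  rw [one_div_one_div] at hv
  constructor
  · rw [← himg, integrableOn_image_iff_integrableOn_abs_deriv_smul measurableSet_Ioi hd hinj] at hi
    exact (integrableOn_congr_fun hcongr measurableSet_Ioi).1 (hi.const_mul _)
  · rw [← himg, integral_image_eq_integral_abs_deriv_smul measurableSet_Ioi hd hinj] at hv
    rw [← setIntegral_congr_fun measurableSet_Ioi hcongr, integral_const_mul, hv]
    ring

theorem matern_half {β r : ℝ} (hβ : 0 < β) (hr : 0 < r) :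
    matern (1 / 2) β r = Real.exp (-(r / β)) := by
  rw [matern_eq_maternIntegral (by norm_num) hβ hr, maternIntegral_half (div_pos hr hβ),
    Real.Gamma_one_half_eq, mul_div_cancel_left₀ _ (Real.sqrt_pos.2 Real.pi_pos).ne']

/-- The exponential is the Gaussian mixture of order 1/2. The fractional integral multiplies the
Gaussian of parameter `s` by a constant times `s ^ ν`, so the order becomes `ν + 1/2`. -/
theorem matern_eq_fracIntegral {ν β r : ℝ} (hν : 0 < ν) (hβ : 0 < β) (hr : 0 < r) :
    matern (ν + 1 / 2) β r = 1 / (β ^ (2 * ν) * Real.Gamma (2 * ν)) *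
      fracIntegral ν (fun w => Real.exp (-(w / β))) r := by
  set K : ℝ → ℝ → ℝ := fun w s => w * (w ^ 2 - r ^ 2) ^ (ν - 1) *
    (s ^ ((1 / 2 : ℝ) - 1) * Real.exp (-s) * Real.exp (-((w / β) ^ 2 / (4 * s)))) with hK
  have hKeq : ∀ w s, K w s = s ^ ((1 / 2 : ℝ) - 1) * Real.exp (-s) *
      (w * (w ^ 2 - r ^ 2) ^ (ν - 1) * Real.exp (-(w ^ 2 / (4 * β ^ 2 * s)))) := by
    intro w s
    simp only [hK]
    rw [show (w / β) ^ 2 / (4 * s) = w ^ 2 / (4 * β ^ 2 * s) by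
      rw [div_pow, div_div]; congr 1; ring]
    ring
  have hinner : ∀ s ∈ Ioi (0 : ℝ), ∫ w in Ioi r, K w s
      = Real.Gamma ν * (4 * β ^ 2) ^ ν / 2 * (s ^ ((ν + 1 / 2) - 1) * Real.exp (-s) *
        Real.exp (-((r / β) ^ 2 / (4 * s)))) := by
    intro s hs
    have hs : 0 < s := hs
    simp only [hKeq]
    rw [integral_const_mul, (integral_mul_sq_sub_sq_rpow_mul_exp hν (by positivity) hr).2,
      Real.mul_rpow (by positivity) hs.le, show ν + 1 / 2 - 1 = (1 / 2 - 1) + ν by ring,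
      Real.rpow_add hs, show (r / β) ^ 2 / (4 * s) = r ^ 2 / (4 * β ^ 2 * s) by
      rw [div_pow, div_div]; congr 1; ring]
    ring
  have hint : Integrable (Function.uncurry K)
      ((volume.restrict (Ioi r)).prod (volume.restrict (Ioi (0 : ℝ)))) := by
    have hmeas : Measurable (Function.uncurry K) := by
      simp only [hK, Function.uncurry_def]
      fun_prop
    rw [integrable_prod_iff' hmeas.aestronglyMeasurable]
    constructor
    · filter_upwards [ae_restrict_mem measurableSet_Ioi] with s hs
      have hs : 0 < s := hs
      simp only [Function.uncurry_apply_pair, hKeq]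
      exact (integral_mul_sq_sub_sq_rpow_mul_exp hν (by positivity) hr).1.const_mul _
    · refine (integrableOn_congr_fun (fun s hs => ?_) measurableSet_Ioi).1
        ((integrableOn_maternIntegral (show 0 < ν + 1 / 2 by positivity) (r / β)).const_mul
          (Real.Gamma ν * (4 * β ^ 2) ^ ν / 2))
      rw [← hinner s hs]
      have hs : 0 < s := hs
      refine setIntegral_congr_fun measurableSet_Ioi fun w hw => ?_
      have hw : r < w := hw
      have h1 : 0 ≤ (w ^ 2 - r ^ 2) ^ (ν - 1) := Real.rpow_nonneg (by nlinarith) _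
      have h2 : 0 < w := by linarith
      simp only [Function.uncurry_apply_pair]
      rw [Real.norm_of_nonneg]
      simp only [hK]
      positivity
  have hpi : 0 < √Real.pi := Real.sqrt_pos.2 Real.pi_pos
  have hfrac : fracIntegral ν (fun w => Real.exp (-(w / β))) r
      = (√Real.pi)⁻¹ * ∫ w in Ioi r, ∫ s in Ioi (0 : ℝ), K w s := by
    rw [fracIntegral, ← integral_const_mul]
    refine setIntegral_congr_fun measurableSet_Ioi fun w hw => ?_
    have hw : r < w := hw
    have h2 : 0 < w := by linarith
    have h3 := maternIntegral_half (div_pos h2 hβ)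
    rw [maternIntegral] at h3
    simp only [hK]
    rw [integral_const_mul, h3]
    generalize (w ^ 2 - r ^ 2) ^ (ν - 1) = A
    generalize Real.exp (-(w / β)) = B
    field_simp
  rw [hfrac, integral_integral_swap hint, setIntegral_congr_fun measurableSet_Ioi hinner,
    integral_const_mul, matern_eq_maternIntegral (by positivity) hβ hr, maternIntegral]
  generalize (∫ s in Ioi (0 : ℝ), s ^ ((ν + 1 / 2) - 1) * Real.exp (-s) *
        Real.exp (-((r / β) ^ 2 / (4 * s)))) = I
  -- Legendre duplication reconciles the two normalising constants.
  have hdup := Real.Gamma_mul_Gamma_add_half ν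
  have h4 : (4 * β ^ 2) ^ ν = 2 ^ (2 * ν) * β ^ (2 * ν) := by
    rw [show 4 * β ^ 2 = (2 * β) ^ (2 : ℝ) by rw [Real.rpow_two]; ring,
      ← Real.rpow_mul (by positivity), Real.mul_rpow zero_le_two hβ.le]
  rw [Real.rpow_sub two_pos, Real.rpow_one] at hdup
  rw [h4]
  have p1 := (Real.Gamma_pos_of_pos (show 0 < ν + 1 / 2 by positivity)).ne'
  have p2 := (Real.Gamma_pos_of_pos (show 0 < 2 * ν by positivity)).ne'
  have p3 : (2 : ℝ) ^ (2 * ν) ≠ 0 := by positivity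
  have p4 := (Real.rpow_pos_of_pos hβ (2 * ν)).ne'
  generalize Real.Gamma (ν + 1 / 2) = A at *
  generalize Real.Gamma (2 * ν) = B at *
  generalize (2 : ℝ) ^ (2 * ν) = C at *
  generalize β ^ (2 * ν) = D at *
  field_simp at hdup ⊢
  linear_combination (-I) * hdup

/-! ### From the truncated power to the exponential, and the growth of `delta`. -/

theorem askey_le_exp {δ μ : ℝ} (hμ : 0 ≤ μ) (w : ℝ) :
    askey δ μ w ≤ Real.exp (-(w / δ * μ)) := by
  have h : max 0 (1 - w / δ) ≤ Real.exp (-(w / δ)) :=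
    max_le (Real.exp_pos _).le (by linarith [Real.add_one_le_exp (-(w / δ))])
  refine (Real.rpow_le_rpow (le_max_left _ _) h hμ).trans_eq ?_
  rw [← Real.exp_mul, neg_mul]

theorem tendsto_askey {δ : ℝ → ℝ} {β : ℝ} (hβ : 0 < β)
    (hδ : Tendsto (fun μ => δ μ / μ) atTop (𝓝 β)) (w : ℝ) :
    Tendsto (fun μ => askey (δ μ) μ w) atTop (𝓝 (Real.exp (-(w / β)))) := by
  have hδtop : Tendsto δ atTop atTop := by
    refine (hδ.pos_mul_atTop hβ tendsto_id).congr' ?_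
    filter_upwards [eventually_gt_atTop 0] with μ hμ
    simp only [id]
    field_simp
  have h1 : Tendsto (fun μ => μ * -(w / δ μ)) atTop (𝓝 (-(w / β))) := by
    have := (hδ.inv₀ hβ.ne').const_mul (-w)
    rw [show -w * β⁻¹ = -(w / β) by ring] at this
    refine this.congr fun μ => ?_
    rw [inv_div]
    ring
  refine (Real.tendsto_one_add_rpow_exp_of_tendsto h1).congr' ?_
  filter_upwards [hδtop.eventually_ge_atTop w, hδtop.eventually_gt_atTop 0] with μ h2 h3
  rw [askey_of_le h3 h2, sub_eq_add_neg]

theorem integrableOn_rpow_mul_exp_neg_div {s β : ℝ} (hs : 0 < s) (hβ : 0 < β) :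
    IntegrableOn (fun w : ℝ => w ^ (s - 1) * Real.exp (-(w / β))) (Ioi 0) := by
  have := integrableOn_rpow_mul_exp_neg_mul_rpow (p := 1) (s := s - 1) (b := 1 / β)
      (by linarith) one_pos (by positivity)
  refine this.congr (Eventually.of_forall fun w => ?_)
  simp only [Real.rpow_one]
  congr 2
  ring

/-- Dominated convergence. The factor `c` absorbs the mismatch of normalising constants when `ν >
0`. -/
theorem tendsto_integral_abs_askey_sub_exp {δ c : ℝ → ℝ} {s β : ℝ} (hs : 0 < s) (hβ : 0 < β)
    (hδ : Tendsto (fun μ => δ μ / μ) atTop (𝓝 β)) (hc : Tendsto c atTop (𝓝 1)) :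
    Tendsto (fun μ => ∫ w in Ioi (0 : ℝ),
      w ^ (s - 1) * |c μ * askey (δ μ) μ w - Real.exp (-(w / β))|) atTop (𝓝 0) := by
  suffices h : Tendsto (fun μ => ∫ w in Ioi (0 : ℝ),
      w ^ (s - 1) * |c μ * askey (δ μ) μ w - Real.exp (-(w / β))|) atTop
      (𝓝 (∫ _ in Ioi (0 : ℝ), (0 : ℝ))) by
    rwa [integral_zero] at h
  refine tendsto_integral_filter_of_dominated_convergence
    (fun w => 2 * (w ^ (s - 1) * Real.exp (-(w / (2 * β)))) + w ^ (s - 1) * Real.exp (-(w / β)))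
    (Eventually.of_forall fun μ => ?_) ?_
    (((integrableOn_rpow_mul_exp_neg_div hs (show 0 < 2 * β by positivity)).const_mul 2).add
      (integrableOn_rpow_mul_exp_neg_div hs hβ)) (Eventually.of_forall fun w => ?_)
  · have := measurable_askey (δ μ) μ
    exact (by fun_prop : Measurable fun w => w ^ (s - 1) *
      |c μ * askey (δ μ) μ w - Real.exp (-(w / β))|).aestronglyMeasurable
  -- Eventually `δ μ < 2 * β * μ` and `|c μ| < 2`; with `1 - x ≤ exp (-x)` these give a majorant
  -- free of `μ`.
  · filter_upwards [eventually_gt_atTop 0, hδ.eventually_lt_const (show β < 2 * β by linarith),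
      hδ.eventually_const_lt hβ, hc.abs.eventually_lt_const (show |(1 : ℝ)| < 2 by norm_num)]
      with μ hμ h1 h2 h3
    filter_upwards [ae_restrict_mem measurableSet_Ioi] with w hw
    have hw : 0 < w := hw
    have hδ0 : 0 < δ μ := by rwa [lt_div_iff₀ hμ, zero_mul] at h2
    rw [div_lt_iff₀ hμ] at h1
    have h4 : askey (δ μ) μ w ≤ Real.exp (-(w / (2 * β))) := by
      refine (askey_le_exp hμ.le w).trans (Real.exp_le_exp.2 (neg_le_neg ?_))
      rw [div_mul_eq_mul_div, div_le_div_iff₀ (by positivity) hδ0, mul_assoc]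
      exact mul_le_mul_of_nonneg_left (by linarith) hw.le
    have h5 := askey_nonneg (δ μ) μ w
    have hp : 0 ≤ w ^ (s - 1) := by positivity
    rw [norm_mul, Real.norm_of_nonneg hp, Real.norm_eq_abs, abs_abs]
    calc w ^ (s - 1) * |c μ * askey (δ μ) μ w - Real.exp (-(w / β))|
        ≤ w ^ (s - 1) * (2 * Real.exp (-(w / (2 * β))) + Real.exp (-(w / β))) := by
          refine mul_le_mul_of_nonneg_left ((abs_sub _ _).trans (add_le_add ?_ ?_)) hp
          · rw [abs_mul, abs_of_nonneg h5]
            exact mul_le_mul h3.le h4 h5 two_pos.le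
          · rw [abs_of_pos (Real.exp_pos _)]
      _ = _ := by ring
  · have h := ((hc.mul (tendsto_askey hβ hδ w)).sub_const (Real.exp (-(w / β)))).abs.const_mul
      (w ^ (s - 1))
    simpa using h

/-- The case `δ μ = μ`, `β = 1`, `c = 1` of the preceding limit says that `μ ^ p * B(p, μ + 1)`
tends to Euler's integral for `Γ(p)`; writing Beta through Gamma gives the ratio, up to a factor `μ
/ (μ + p)`. -/
theorem tendsto_Gamma_add_div_mul_rpow {p : ℝ} (hp : 0 < p) :
    Tendsto (fun μ : ℝ => Real.Gamma (μ + p) / (Real.Gamma μ * μ ^ p)) atTop (𝓝 1) := by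
  have hG := Real.Gamma_pos_of_pos hp
  have h1 : Tendsto (fun μ : ℝ => μ ^ p * ProbabilityTheory.beta p (μ + 1)) atTop
      (𝓝 (Real.Gamma p)) := by
    have hid : Tendsto (fun μ : ℝ => id μ / μ) atTop (𝓝 1) :=
      tendsto_const_nhds.congr' (by
        filter_upwards [eventually_gt_atTop 0] with μ hμ
        simp [hμ.ne'])
    have h := tendsto_integral_abs_askey_sub_exp hp one_pos hid
      (tendsto_const_nhds (x := (1 : ℝ)))
    rw [tendsto_iff_norm_sub_tendsto_zero]
    refine squeeze_zero' (Eventually.of_forall fun μ => norm_nonneg _) ?_ h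
    filter_upwards [eventually_gt_atTop 0] with μ hμ
    obtain ⟨i1, i2⟩ := integral_rpow_mul_askey hp hμ hμ
    have i3 := integrableOn_rpow_mul_exp_neg hp
    have e : Real.Gamma p = ∫ s in Ioi (0 : ℝ), s ^ (p - 1) * Real.exp (-s) := by
      rw [Real.Gamma_eq_integral hp]
      simp only [mul_comm]
    rw [← i2, e, ← integral_sub i1 i3]
    refine (norm_integral_le_integral_norm _).trans_eq
      (setIntegral_congr_fun measurableSet_Ioi fun w hw => ?_)
    have hw : 0 < w := hw
    simp only [id, one_mul, div_one]
    rw [← mul_sub, norm_mul, Real.norm_of_nonneg (by positivity), Real.norm_eq_abs]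
  have h2 : Tendsto (fun μ : ℝ => μ / (μ + p)) atTop (𝓝 1) := by
    have h3 : Tendsto (fun μ : ℝ => 1 / (1 + p / μ)) atTop (𝓝 1) := by
      have h4 := ((tendsto_const_nhds (x := p)).div_atTop tendsto_id).const_add (1 : ℝ)
      simpa using h4.inv₀ (by norm_num)
    refine h3.congr' ?_
    filter_upwards [eventually_gt_atTop 0] with μ hμ
    field_simp
  have h6 := (h2.mul (h1.inv₀ hG.ne')).mul_const (Real.Gamma p)
  rw [one_mul, inv_mul_cancel₀ hG.ne'] at h6
  refine h6.congr' ?_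
  filter_upwards [eventually_gt_atTop 0] with μ hμ
  have q1 := (Real.Gamma_pos_of_pos hμ).ne'
  have q2 := (Real.Gamma_pos_of_pos (show 0 < μ + p by positivity)).ne'
  rw [ProbabilityTheory.beta, show p + (μ + 1) = μ + p + 1 by ring,
    Real.Gamma_add_one (s := μ + p) (by positivity), Real.Gamma_add_one hμ.ne']
  have q3 := (Real.rpow_pos_of_pos hμ p).ne'
  have q4 : μ + p ≠ 0 := by positivity
  generalize Real.Gamma (μ + p) = A at *
  field_simp

theorem tendsto_delta_div {ν β : ℝ} (hν : 0 ≤ ν) :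
    Tendsto (fun μ => delta ν μ β / μ) atTop (𝓝 β) := by
  have hp : 0 < 1 + 2 * ν := by positivity
  have h := ((tendsto_Gamma_add_div_mul_rpow hp).rpow_const (p := 1 / (1 + 2 * ν))
    (Or.inl one_ne_zero)).const_mul β
  rw [Real.one_rpow, mul_one] at h
  refine h.congr' ?_
  filter_upwards [eventually_gt_atTop 0] with μ hμ
  have q1 := Real.Gamma_pos_of_pos hμ
  have q2 := Real.Gamma_pos_of_pos (show 0 < μ + (1 + 2 * ν) by positivity)
  rw [delta, ← div_div, Real.div_rpow (by positivity) (by positivity), ← Real.rpow_mul hμ.le,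
    mul_one_div_cancel hp.ne', Real.rpow_one, show μ + (1 + 2 * ν) = μ + 2 * ν + 1 by ring,
    mul_div_assoc]

/-- The exponent `1 / (1 + 2ν)` in `delta` is chosen for this: the Wendland constant equals the
Matérn constant times `δ / (μ β)`, which tends to 1. -/
theorem delta_rpow_div_beta {ν μ β : ℝ} (hν : 0 < ν) (hμ : 0 < μ) (hβ : 0 < β) :
    delta ν μ β ^ (-(2 * ν)) / ProbabilityTheory.beta (2 * ν) (μ + 1)
      = 1 / (β ^ (2 * ν) * Real.Gamma (2 * ν)) * (delta ν μ β / μ / β) := by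
  have hδ := delta_pos hν.le hμ hβ
  have q1 := Real.Gamma_pos_of_pos hμ
  have q2 := Real.Gamma_pos_of_pos (show 0 < μ + 2 * ν + 1 by positivity)
  have q3 := Real.Gamma_pos_of_pos (show 0 < 2 * ν by positivity)
  have hp : (1 : ℝ) + 2 * ν ≠ 0 := by positivity
  have h : delta ν μ β ^ (2 * ν) * delta ν μ β
      = β ^ (2 * ν) * β * (Real.Gamma (μ + 2 * ν + 1) / Real.Gamma μ) := by
    rw [← Real.rpow_add_one hδ.ne', ← Real.rpow_add_one hβ.ne', delta,
      Real.mul_rpow hβ.le (by positivity), ← Real.rpow_mul (by positivity),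
      show 1 / (1 + 2 * ν) * (2 * ν + 1) = 1 by field_simp; ring, Real.rpow_one]
  rw [Real.rpow_neg hδ.le, ProbabilityTheory.beta, Real.Gamma_add_one hμ.ne',
    show 2 * ν + (μ + 1) = μ + 2 * ν + 1 by ring]
  have p1 := Real.rpow_pos_of_pos hδ (2 * ν)
  have p2 := Real.rpow_pos_of_pos hβ (2 * ν)
  generalize delta ν μ β ^ (2 * ν) = A at *
  generalize β ^ (2 * ν) = B at *
  generalize Real.Gamma (μ + 2 * ν + 1) = C at *
  generalize Real.Gamma (2 * ν) = D at *
  field_simp at h ⊢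
  linear_combination -h

/-! ### Convergence in weighted L¹ and of the spectral densities. -/

theorem tendsto_integral_abs_phi_sub_matern {d : ℕ} (hd : 1 ≤ d) {ν β : ℝ} (hν : 0 ≤ ν)
    (hβ : 0 < β) :
    Tendsto (fun μ => ∫ r in Ioi (0 : ℝ),
      |phi ν μ β r * r ^ (d - 1) - matern (ν + 1 / 2) β r * r ^ (d - 1)|) atTop (𝓝 0) := by
  have hd0 : (0 : ℝ) < d := by exact_mod_cast hd
  have hpow : ∀ r : ℝ, r ^ (d - 1) = r ^ ((d : ℝ) - 1) := fun r => by
    rw [← Real.rpow_natCast, Nat.cast_sub hd, Nat.cast_one]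
  have hδ := tendsto_delta_div (β := β) hν
  rcases hν.eq_or_lt with rfl | hν
  · refine (tendsto_integral_abs_askey_sub_exp hd0 hβ hδ
      (tendsto_const_nhds (x := (1 : ℝ)))).congr' ?_
    filter_upwards [eventually_gt_atTop 0] with μ hμ
    refine setIntegral_congr_fun measurableSet_Ioi fun r hr => ?_
    have hr : 0 < r := hr
    simp only [hpow, phi, zero_add, one_mul]
    rw [genWendland_zero (delta_pos le_rfl hμ hβ) hμ, matern_half hβ hr, ← sub_mul, abs_mul,
      abs_of_nonneg (Real.rpow_nonneg hr.le _), mul_comm]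
  · set κ := 1 / (β ^ (2 * ν) * Real.Gamma (2 * ν)) with hκ
    have hκ0 : 0 < κ := by
      have := Real.Gamma_pos_of_pos (show 0 < 2 * ν by positivity)
      positivity
    have hc : Tendsto (fun μ => delta ν μ β / μ / β) atTop (𝓝 1) := by
      have := hδ.div_const β
      rwa [div_self hβ.ne'] at this
    have hs : 0 < (d : ℝ) + 2 * ν := by positivity
    -- The weight exponent is `d + 2ν`, as the fractional integral gains `2ν` powers; the Beta
    -- factor is its norm.
    have hlim := (tendsto_integral_abs_askey_sub_exp hs hβ hδ hc).const_mul
      (κ * (ProbabilityTheory.beta ((d : ℝ) / 2) ν / 2))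
    rw [mul_zero] at hlim
    refine squeeze_zero' (Eventually.of_forall fun μ => integral_nonneg fun r => abs_nonneg _) ?_
      hlim
    filter_upwards [eventually_gt_atTop 0] with μ hμ
    have hδ0 := delta_pos hν.le hμ hβ
    set c := delta ν μ β / μ / β with hcdef
    have hm1 : Measurable fun w => c * askey (delta ν μ β) μ w :=
      (measurable_askey _ _).const_mul c
    have hm2 : Measurable fun w : ℝ => Real.exp (-(w / β)) := by fun_prop
    have i1 : IntegrableOn (fun w => w ^ ((d : ℝ) + 2 * ν - 1) *
        (c * askey (delta ν μ β) μ w)) (Ioi 0) := by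
      simpa only [IntegrableOn, mul_left_comm _ c] using
        (integral_rpow_mul_askey hs hδ0 hμ).1.const_mul c
    have i2 := integrableOn_rpow_mul_exp_neg_div hs hβ
    have i3 : IntegrableOn (fun w => w ^ ((d : ℝ) + 2 * ν - 1) *
        (c * askey (delta ν μ β) μ w - Real.exp (-(w / β)))) (Ioi 0) := by
      simpa only [IntegrableOn, mul_sub] using! i1.sub i2
    have hle := integral_rpow_mul_abs_fracIntegral_le hd0 hν (hm1.sub hm2) i3
    refine le_trans (le_of_eq ?_) ((mul_le_mul_of_nonneg_left hle hκ0.le).trans_eq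
      (mul_assoc _ _ _).symm)
    rw [← integral_const_mul]
    refine integral_congr_ae ?_
    filter_upwards [ae_restrict_mem measurableSet_Ioi,
      ae_integrableOn_fracIntegral hd0 hν hm1 i1, ae_integrableOn_fracIntegral hd0 hν hm2 i2]
      with r hr j1 j2
    have hr : 0 < r := hr
    have e1 : phi ν μ β r = κ * fracIntegral ν (fun w => c * askey (delta ν μ β) μ w) r := by
      rw [phi, genWendland_of_pos hν hδ0 hμ hr, delta_rpow_div_beta hν hμ hβ, mul_assoc,
        fracIntegral, fracIntegral, ← integral_const_mul]
      simp only [mul_left_comm _ c, ← hcdef, hκ]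
    have e2 : fracIntegral ν ((fun w => c * askey (delta ν μ β) μ w) -
          fun w => Real.exp (-(w / β))) r
        = fracIntegral ν (fun w => c * askey (delta ν μ β) μ w) r -
          fracIntegral ν (fun w => Real.exp (-(w / β))) r := by
      simp only [fracIntegral, Pi.sub_apply, mul_sub]
      exact integral_sub j1 j2
    rw [e1, matern_eq_fracIntegral hν hβ hr, hpow, ← sub_mul, ← mul_sub, abs_mul, abs_mul,
      abs_of_pos hκ0, abs_of_nonneg (Real.rpow_nonneg hr.le _), e2]
    ring

/-- The right-hand side does not involve `z`, which is the source of the uniformity. -/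
theorem abs_spectralDensity_sub_le {d : ℕ} (hd : 1 ≤ d) {φ ψ : ℝ → ℝ}
    (hφ : IntegrableOn (fun r => φ r * r ^ (d - 1)) (Ioi 0))
    (hψ : IntegrableOn (fun r => ψ r * r ^ (d - 1)) (Ioi 0)) {z : ℝ} (hz : 0 < z) :
    |spectralDensity d φ z - spectralDensity d ψ z|
      ≤ 2 ^ (1 - (d : ℝ) / 2) / (2 * Real.pi) ^ ((d : ℝ) / 2) * (1 / Real.Gamma ((d : ℝ) / 2) *
        ∫ r in Ioi (0 : ℝ), |φ r * r ^ (d - 1) - ψ r * r ^ (d - 1)|) := by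
  have hd1 : (1 : ℝ) ≤ d := by exact_mod_cast hd
  have hbd : ∀ u, |besselEntire ((d : ℝ) / 2 - 1) (u * z)| ≤ 1 / Real.Gamma ((d : ℝ) / 2) := by
    intro u
    have := abs_besselEntire_le (a := (d : ℝ) / 2 - 1) (by linarith) (u * z)
    rwa [sub_add_cancel] at this
  have hb : AEStronglyMeasurable (fun u => besselEntire ((d : ℝ) / 2 - 1) (u * z))
      (volume.restrict (Ioi (0 : ℝ))) :=
    ((measurable_besselEntire (by linarith)).comp
      (by fun_prop : Measurable fun u : ℝ => u * z)).aestronglyMeasurable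
  have i1 := Integrable.bdd_mul hφ hb (Eventually.of_forall hbd)
  have i2 := Integrable.bdd_mul hψ hb (Eventually.of_forall hbd)
  rw [spectralDensity_eq_integral_besselEntire hd _ hz,
    spectralDensity_eq_integral_besselEntire hd _ hz, ← mul_sub, abs_mul,
    abs_of_pos (by positivity), ← integral_sub i1 i2, ← integral_const_mul]
  refine mul_le_mul_of_nonneg_left ?_ (by positivity)
  rw [← Real.norm_eq_abs]
  refine norm_integral_le_of_norm_le ((hφ.sub hψ).abs.const_mul _) (Eventually.of_forall fun u => ?_)
  rw [← mul_sub, norm_mul]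
  exact mul_le_mul_of_nonneg_right (hbd u) (norm_nonneg _)

theorem tendstoUniformlyOn_spectralDensity_phi {d : ℕ} (hd : 1 ≤ d) {ν β : ℝ} (hν : 0 ≤ ν)
    (hβ : 0 < β) :
    TendstoUniformlyOn (fun μ : ℝ => spectralDensity d (phi ν μ β))
      (spectralDensity d (matern (ν + 1 / 2) β)) atTop (Ioi 0) := by
  have hlim := ((tendsto_integral_abs_phi_sub_matern hd hν hβ).const_mul
    (1 / Real.Gamma ((d : ℝ) / 2))).const_mul
    ((2 : ℝ) ^ (1 - (d : ℝ) / 2) / (2 * Real.pi) ^ ((d : ℝ) / 2))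
  rw [mul_zero, mul_zero] at hlim
  rw [Metric.tendstoUniformlyOn_iff]
  intro ε hε
  filter_upwards [hlim.eventually_lt_const hε, eventually_gt_atTop 0] with μ h1 hμ z hz
  rw [dist_comm, Real.dist_eq]
  exact (abs_spectralDensity_sub_le hd
    (integrableOn_genWendland hd hν (delta_pos hν hμ hβ) hμ)
    (integrableOn_matern hd (by positivity) hβ) hz).trans_lt h1

end Wendland

end

theorem theorem2 (d : ℕ) (hd : 1 ≤ d) (ν β : ℝ) (hν : 0 ≤ ν) (hβ : 0 < β) :
    -- the spectral density of `φ_{ν,μ,β}` is well defined and given by the `₁F₂` expression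
    (∀ μ : ℝ, 0 < μ →
      MeasureTheory.IntegrableOn (fun r : ℝ => Wendland.phi ν μ β r * r ^ (d - 1)) (Set.Ioi 0) ∧
      ∀ z : ℝ, 0 < z →
        Wendland.spectralDensity d (Wendland.phi ν μ β) z =
          Wendland.genWendlandDensity d ν μ (Wendland.delta ν μ β) z) ∧
    -- the spectral density of `M_{ν+1/2,β}` is well defined and given by its closed form
    (MeasureTheory.IntegrableOn
        (fun r : ℝ => Wendland.matern (ν + 1 / 2) β r * r ^ (d - 1)) (Set.Ioi 0) ∧
      ∀ z : ℝ, 0 < z →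
        Wendland.spectralDensity d (Wendland.matern (ν + 1 / 2) β) z =
          Wendland.maternDensity d (ν + 1 / 2) β z) ∧
    -- uniform convergence on every bounded subinterval of the positive real line
    (∀ I : Set ℝ, I.OrdConnected → Bornology.IsBounded I → I ⊆ Set.Ioi 0 →
      TendstoUniformlyOn (fun μ : ℝ => Wendland.spectralDensity d (Wendland.phi ν μ β))
        (Wendland.spectralDensity d (Wendland.matern (ν + 1 / 2) β)) Filter.atTop I) := by
  have ha : 0 < ν + 1 / 2 := by positivity
  refine ⟨fun μ hμ => ?_, ?_, fun I _ _ hI =>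
    (Wendland.tendstoUniformlyOn_spectralDensity_phi hd hν hβ).mono hI⟩
  · have hδ := Wendland.delta_pos hν hμ hβ
    exact ⟨Wendland.integrableOn_genWendland hd hν hδ hμ,
      fun z hz => Wendland.spectralDensity_genWendland hd hν hδ hμ hz⟩
  · exact ⟨Wendland.integrableOn_matern hd ha hβ,
      fun z hz => Wendland.spectralDensity_matern hd ha hβ hz⟩
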